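/- For a finite simple graph $G=(V,E)$ let $\chi_G(x)=\sum_{A\subseteq E}(-1)^{|A|}x^{\kappa(A)}$ be its chromatic polynomial, where $\kappa(A)$ is the number of connected components of $(V,A)$, and let $\Delta(G)$ be its maximum degree; forests have infinite girth. For an integer $g\ge 3$ put $$f_g(a,b)=\exp\left(\frac{(1-a)\ln b}{b}\right)-1+\frac{b(\ln b)^{g-1}}{2(1-\ln b)},$$ $$X_g=\{(a,b): f_g(a,b)\le a,\ a\in[0,0.9],\ b\in[1.1,e)\},\qquad K_g=\min_{(a,b)\in X_g}\frac{b}{(1-a)\ln b}.$$ Then for every $g\ge 3$ this minimum is attained (in particular $X_g\neq\emptyset$), and for every finite simple graph $G$ of girth at least $g$ and every $x\in\mathbb{C}$ with $|x|\ge K_g\Delta(G)$, where $x\ne 0$ is required in case $G$ has no edges, one has $\chi_G(x)\neq 0$. Moreover the limit of $K_g$ as $g\to\infty$ exists and $$\lim_{g\to\infty}K_g=\frac{1}{1+\ln W(e^{2/e-1})}\le 3.86,$$ where $W$ is the Lambert function (for $y>0$, $W(y)$ is the unique real solution $w$ of $we^w=y$); this limit equals $3.85977$ to within $5\cdot 10^{-6}$.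 -/

import Mathlib

open scoped Topology

noncomputable section

/-- The chromatic polynomial `∑_{A ⊆ E} (-1)^|A| X^κ(A)` of a finite simple graph, where `κ(A)` is
the number of connected components of the spanning subgraph `(V, A)`. -/
def chromaticPoly {V : Type*} [Fintype V] [DecidableEq V] (G : SimpleGraph V)
    [DecidableRel G.Adj] : Polynomial ℤ :=
  ∑ A ∈ G.edgeFinset.powerset, (-1) ^ A.card *
    Polynomial.X ^ Nat.card (SimpleGraph.fromEdgeSet (A : Set (Sym2 V))).ConnectedComponent

/-- The objective function `1 / h(a,b) = b / ((1 - a) ln b)`. -/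
def girthObjective (p : ℝ × ℝ) : ℝ :=
  p.2 / ((1 - p.1) * Real.log p.2)

/-- The constraint function
`f_g(a,b) = exp((1 - a) ln b / b) - 1 + b (ln b)^(g-1) / (2 (1 - ln b))`, for `g ≥ 1`. -/
def girthConstraint (g : ℕ) (a b : ℝ) : ℝ :=
  Real.exp ((1 - a) * Real.log b / b) - 1 +
    b * Real.log b ^ (g - 1) / (2 * (1 - Real.log b))

/-- The feasible set `X_g = {(a,b) : f_g(a,b) ≤ a, a ∈ [0, 0.9], b ∈ [1.1, e)}`. -/
def girthFeasible (g : ℕ) : Set (ℝ × ℝ) :=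
  {p | girthConstraint g p.1 p.2 ≤ p.1 ∧ p.1 ∈ Set.Icc (0 : ℝ) 0.9 ∧
    p.2 ∈ Set.Ico (1.1 : ℝ) (Real.exp 1)}

/-- The constant `K_g`: the optimal value of minimising `b / ((1 - a) ln b)` over `X_g`. -/
def girthK (g : ℕ) : ℝ :=
  sInf (girthObjective '' girthFeasible g)

/-- The Lambert function `W` (principal branch): the inverse of `w ↦ w e^w` on `[-1, ∞)`. -/
def lambertW (y : ℝ) : ℝ :=
  Function.invFunOn (fun w : ℝ => w * Real.exp w) (Set.Ici (-1)) y

/-- For `y > 0`, `W(y)` is the unique real solution of `w e^w = y`. -/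
theorem lambertW_unique {y : ℝ} (hy : 0 < y) (w : ℝ) :
    w * Real.exp w = y ↔ w = lambertW y := by
  have key : ∃ a ∈ Set.Ici (-1 : ℝ), a * Real.exp a = y := by
    have hc : ContinuousOn (fun w : ℝ => w * Real.exp w) (Set.Icc 0 y) := by fun_prop
    have h := intermediate_value_Icc hy.le hc
    have hm : y ∈ Set.Icc ((0 : ℝ) * Real.exp 0) (y * Real.exp y) := by
      refine ⟨by simpa using hy.le, ?_⟩
      have := Real.one_le_exp hy.le
      nlinarith
    obtain ⟨a, ha, h2⟩ := h hm
    exact ⟨a, by have := ha.1; simp only [Set.mem_Ici]; linarith, h2⟩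
  have hW : lambertW y * Real.exp (lambertW y) = y :=
    Function.invFunOn_eq (f := fun w : ℝ => w * Real.exp w) key
  have pos : ∀ v : ℝ, v * Real.exp v = y → 0 < v := fun v hv =>
    pos_of_mul_pos_left (by rw [hv]; exact hy) (Real.exp_pos v).le
  refine ⟨fun h => ?_, fun h => h ▸ hW⟩
  have h1 := pos _ h
  have h2 := pos _ hW
  rcases lt_trichotomy w (lambertW y) with h3 | h3 | h3
  · have := mul_lt_mul h3 (Real.exp_le_exp.2 h3.le) (Real.exp_pos _) h2.le
    linarith
  · exact h3
  · have := mul_lt_mul h3 (Real.exp_le_exp.2 h3.le) (Real.exp_pos _) h1.le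
    linarith

end

/-! Put `q = 1/x`; up to a power of `x` the chromatic polynomial is `rankSum q E`. Vertices are
added one at a time, and strong induction shows that adding a vertex shrinks the norm of `rankSum`
by a factor of at least `1 - a`, so it never vanishes.

To add `u`, attach its edges singly. By `rankSum_insert`, each edge contributes a factor `1 - q` and
a correction summed over the connected sets `S` containing both endpoints. The inductive ratio bound
pays `(1 - a)⁻¹` per vertex for deleting `S`, so the correction is bounded by the weights
`connWeight` with parameter `c = ‖q‖ / (1 - a)`. The recursion `connSum_insert` for signed counts of
connected spanning subgraphs bounds these weights by `b` on the diagonal and by a generating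
function of walks off it (`connWeight_le_sum_walks`). Two neighbours of `u` are joined by no walk
avoiding `u` of length below `g - 2`, since such a walk would close to a short cycle. The remaining
walks form a geometric tail of ratio at most `ln b`, which is the last term of `f_g`; the factor `1
+ ‖q‖` per edge gives its exponential. `rankSum_ne_zero_and_le` assembles this.

For the limit, write `h = (1 - a) ln b / b`. Feasibility forces `exp h - 1 ≤ a`, and `ln b / b ≤
1/e` gives `e h ≤ 1 - a`, hence `exp h + e h ≤ 2`. Equality defines `limitRate`; it is approached as
`b` tends to `e`, where the tail term vanishes as `g` grows for each fixed `b < e`. -/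

/-! ### Connected components of edge sets -/

section Clusters

open Finset

variable {V : Type*} [Fintype V] [DecidableEq V]

open Classical in
/-- The vertex set of the connected component of `u` in the graph with edge set `A`. -/
noncomputable def cluster (A : Finset (Sym2 V)) (u : V) : Finset V :=
  {v | (SimpleGraph.fromEdgeSet (A : Set (Sym2 V))).Reachable u v}

theorem mem_cluster {A : Finset (Sym2 V)} {u v : V} :
    v ∈ cluster A u ↔ (SimpleGraph.fromEdgeSet (A : Set (Sym2 V))).Reachable u v := by
  simp [cluster]

theorem self_mem_cluster (A : Finset (Sym2 V)) (u : V) : u ∈ cluster A u :=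
  mem_cluster.2 (SimpleGraph.Reachable.refl u)

theorem cluster_eq_of_mem {A : Finset (Sym2 V)} {u v : V} (h : v ∈ cluster A u) :
    cluster A v = cluster A u := by
  ext w
  rw [mem_cluster] at h
  rw [mem_cluster, mem_cluster]
  exact ⟨fun hw => h.trans hw, fun hw => h.symm.trans hw⟩

theorem mem_cluster_comm {A : Finset (Sym2 V)} {u v : V} :
    v ∈ cluster A u ↔ u ∈ cluster A v := by
  rw [mem_cluster, mem_cluster, SimpleGraph.reachable_comm]

theorem mem_cluster_of_edge {A : Finset (Sym2 V)} {u x y : V} (hx : x ∈ cluster A u)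
    (he : s(x, y) ∈ A) : y ∈ cluster A u := by
  -- `A` may contain loops, which `fromEdgeSet` discards.
  by_cases hxy : x = y
  · exact hxy ▸ hx
  · rw [mem_cluster] at hx ⊢
    exact hx.trans (SimpleGraph.Adj.reachable (by simp [he, hxy]))

theorem cluster_subset_of_closed {A : Finset (Sym2 V)} {u : V} {S : Finset V} (hu : u ∈ S)
    (h : ∀ x ∈ S, ∀ y, s(x, y) ∈ A → y ∈ S) : cluster A u ⊆ S := by
  intro v hv
  rw [mem_cluster] at hv
  obtain ⟨p⟩ := hv
  induction p with
  | nil => exact hu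
  | cons hadj _ ih =>
    simp only [SimpleGraph.fromEdgeSet_adj, mem_coe] at hadj
    exact ih (h _ hu _ hadj.1)

theorem cluster_mono {A B : Finset (Sym2 V)} (h : A ⊆ B) (u : V) : cluster A u ⊆ cluster B u :=
  cluster_subset_of_closed (self_mem_cluster B u) fun _ hx _ he => mem_cluster_of_edge hx (h he)

theorem cluster_subset_of_subset_sym2 {A : Finset (Sym2 V)} {u : V} {S : Finset V} (hu : u ∈ S)
    (hA : A ⊆ S.sym2) : cluster A u ⊆ S :=
  cluster_subset_of_closed hu fun _ _ _ he => (mk_mem_sym2_iff.1 (hA he)).2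

theorem cluster_union_left {A B : Finset (Sym2 V)} {u : V} {S : Finset V} (hu : u ∈ S)
    (hA : A ⊆ S.sym2) (hB : B ⊆ Sᶜ.sym2) : cluster (A ∪ B) u = cluster A u := by
  refine Subset.antisymm (cluster_subset_of_closed (self_mem_cluster A u) ?_)
    (cluster_mono subset_union_left u)
  intro x hx y he
  rcases mem_union.1 he with he | he
  · exact mem_cluster_of_edge hx he
  · exact absurd (cluster_subset_of_subset_sym2 hu hA hx)
      (mem_compl.1 (mk_mem_sym2_iff.1 (hB he)).1)

theorem cluster_union_right {A B : Finset (Sym2 V)} {u : V} {S : Finset V} (hu : u ∉ S)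
    (hA : A ⊆ S.sym2) (hB : B ⊆ Sᶜ.sym2) : cluster (A ∪ B) u = cluster B u := by
  rw [union_comm]
  exact cluster_union_left (S := Sᶜ) (mem_compl.2 hu) hB (by rwa [compl_compl])

theorem cluster_insert_of_mem {A : Finset (Sym2 V)} {u v : V} (h : v ∈ cluster A u) (x : V) :
    cluster (insert s(u, v) A) x = cluster A x := by
  refine Subset.antisymm (cluster_subset_of_closed (self_mem_cluster A x) ?_)
    (cluster_mono (subset_insert _ _) x)
  intro y hy z he
  rcases mem_insert.1 he with he | he
  · rw [← cluster_eq_of_mem hy]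
    rcases Sym2.eq_iff.1 he with ⟨rfl, rfl⟩ | ⟨rfl, rfl⟩
    · exact h
    · exact mem_cluster_comm.1 h
  · exact mem_cluster_of_edge hy he

theorem cluster_insert_left (A : Finset (Sym2 V)) (u v : V) :
    cluster (insert s(u, v) A) u = cluster A u ∪ cluster A v := by
  refine Subset.antisymm
    (cluster_subset_of_closed (mem_union_left _ (self_mem_cluster A u)) ?_) ?_
  · intro x hx y he
    rcases mem_insert.1 he with he | he
    · rcases Sym2.eq_iff.1 he with ⟨rfl, rfl⟩ | ⟨rfl, rfl⟩
      · exact mem_union_right _ (self_mem_cluster A _)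
      · exact mem_union_left _ (self_mem_cluster A _)
    · rcases mem_union.1 hx with hx | hx
      · exact mem_union_left _ (mem_cluster_of_edge hx he)
      · exact mem_union_right _ (mem_cluster_of_edge hx he)
  · have hv : v ∈ cluster (insert s(u, v) A) u :=
      mem_cluster_of_edge (self_mem_cluster _ u) (mem_insert_self _ _)
    refine union_subset (cluster_mono (subset_insert _ _) u) ?_
    rw [← cluster_eq_of_mem hv]
    exact cluster_mono (subset_insert _ _) v

theorem cluster_insert_of_notMem {A : Finset (Sym2 V)} {u v x : V} (hu : x ∉ cluster A u)
    (hv : x ∉ cluster A v) : cluster (insert s(u, v) A) x = cluster A x := by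
  refine Subset.antisymm (cluster_subset_of_closed (self_mem_cluster A x) ?_)
    (cluster_mono (subset_insert _ _) x)
  intro y hy z he
  rcases mem_insert.1 he with he | he
  · rcases Sym2.eq_iff.1 he with ⟨rfl, rfl⟩ | ⟨rfl, rfl⟩
    · exact absurd (mem_cluster_comm.1 hy) hu
    · exact absurd (mem_cluster_comm.1 hy) hv
  · exact mem_cluster_of_edge hy he

theorem cluster_empty (u : V) : cluster (∅ : Finset (Sym2 V)) u = {u} :=
  Subset.antisymm (cluster_subset_of_closed (mem_singleton_self u) (by simp))
    (singleton_subset_iff.2 (self_mem_cluster _ u))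

/-- The number of connected components of the graph with edge set `A`. -/
noncomputable def numClusters (A : Finset (Sym2 V)) : ℕ := #(univ.image (cluster A))

theorem numClusters_le (A : Finset (Sym2 V)) : numClusters A ≤ Fintype.card V :=
  card_image_le

theorem numClusters_empty : numClusters (∅ : Finset (Sym2 V)) = Fintype.card V := by
  rw [numClusters, card_image_of_injective, card_univ]
  intro x y h
  simpa [cluster_empty] using h

theorem natCard_connectedComponent (A : Finset (Sym2 V)) :
    Nat.card (SimpleGraph.fromEdgeSet (A : Set (Sym2 V))).ConnectedComponent = numClusters A := by
  classical
  let f : (SimpleGraph.fromEdgeSet (A : Set (Sym2 V))).ConnectedComponent → Finset V :=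
    fun c => c.recOn (fun v => cluster A v) fun v w p _ => by
      simpa using (cluster_eq_of_mem (mem_cluster.2 ⟨p⟩)).symm
  have hf : Function.Injective f := by
    intro c d
    refine SimpleGraph.ConnectedComponent.ind₂ (fun v w (h : cluster A v = cluster A w) => ?_) c d
    exact SimpleGraph.ConnectedComponent.sound
      (mem_cluster.1 (h ▸ self_mem_cluster A w))
  have hr : Set.range f = (univ.image (cluster A) : Finset (Finset V)) := by
    ext S
    simp only [Set.mem_range, coe_image, coe_univ, Set.image_univ]
    constructor
    · rintro ⟨c, rfl⟩
      exact SimpleGraph.ConnectedComponent.ind (fun v => ⟨v, rfl⟩) c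
    · rintro ⟨v, rfl⟩
      exact ⟨SimpleGraph.connectedComponentMk _ v, rfl⟩
  rw [← Nat.card_range_of_injective hf, hr, numClusters, Nat.card_coe_set_eq,
    Set.ncard_coe_finset]

theorem numClusters_insert_of_mem {A : Finset (Sym2 V)} {u v : V} (h : v ∈ cluster A u) :
    numClusters (insert s(u, v) A) = numClusters A := by
  rw [numClusters, numClusters, funext (cluster_insert_of_mem h)]

theorem card_image_cluster_split (A : Finset (Sym2 V)) (S : Finset V)
    (h : ∀ x ∈ S, cluster A x ⊆ S) :
    numClusters A = #(S.image (cluster A)) + #(Sᶜ.image (cluster A)) := by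
  rw [numClusters, ← union_compl S, image_union, card_union_of_disjoint]
  rw [disjoint_left]
  intro C h1 h2
  obtain ⟨x, hx, rfl⟩ := mem_image.1 h1
  obtain ⟨y, hy, hxy⟩ := mem_image.1 h2
  exact mem_compl.1 hy (h x hx (hxy ▸ self_mem_cluster A y))

theorem numClusters_insert_of_notMem {A : Finset (Sym2 V)} {u v : V} (h : v ∉ cluster A u) :
    numClusters A = numClusters (insert s(u, v) A) + 1 := by
  set S := cluster A u ∪ cluster A v with hS
  have hSu := cluster_insert_left A u v
  have hin : ∀ x ∈ S, cluster (insert s(u, v) A) x = S := fun x hx => by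
    rw [hS, ← hSu] at hx ⊢
    exact cluster_eq_of_mem hx
  have hout : Sᶜ.image (cluster (insert s(u, v) A)) = Sᶜ.image (cluster A) := by
    refine image_congr fun x hx => ?_
    simp only [coe_compl, Set.mem_compl_iff, mem_coe, hS, mem_union, not_or] at hx
    exact cluster_insert_of_notMem hx.1 hx.2
  have hne : S.Nonempty := ⟨u, mem_union_left _ (self_mem_cluster A u)⟩
  have h1 : S.image (cluster (insert s(u, v) A)) = {S} := by
    rw [image_congr (g := fun _ => S) (fun x hx => hin x hx), image_const hne]
  have h2 : S.image (cluster A) = {cluster A u, cluster A v} := by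
    ext C
    simp only [mem_image, hS, mem_union, mem_insert, mem_singleton]
    constructor
    · rintro ⟨x, hx | hx, rfl⟩
      · exact Or.inl (cluster_eq_of_mem hx)
      · exact Or.inr (cluster_eq_of_mem hx)
    · rintro (rfl | rfl)
      · exact ⟨u, Or.inl (self_mem_cluster A u), rfl⟩
      · exact ⟨v, Or.inr (self_mem_cluster A v), rfl⟩
  have huv : cluster A u ≠ cluster A v := fun hc => h (hc ▸ self_mem_cluster A v)
  rw [card_image_cluster_split A S, card_image_cluster_split (insert s(u, v) A) S, h1, h2, hout,
    card_pair huv, card_singleton]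
  · ring
  · exact fun x hx => (hin x hx).le
  · exact fun x hx => (cluster_mono (subset_insert _ _) x).trans (hin x hx).le

/-- In `B` every vertex of `S` is isolated and so counts once; adding `A` merges these `#S`
singletons into one component and leaves the others alone. -/
theorem numClusters_union {A B : Finset (Sym2 V)} {S : Finset V} {u : V}
    (hA : A ⊆ S.sym2) (hB : B ⊆ Sᶜ.sym2) (hS : cluster A u = S) :
    numClusters (A ∪ B) + #S = numClusters B + 1 := by
  have hu : u ∈ S := hS ▸ self_mem_cluster A u
  have hin : ∀ x ∈ S, cluster (A ∪ B) x = S := fun x hx => by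
    rw [cluster_union_left hx hA hB, cluster_eq_of_mem (hS.symm ▸ hx), hS]
  have hB' : ∀ x ∈ S, cluster B x = {x} := fun x hx => by
    refine Subset.antisymm (cluster_subset_of_closed (mem_singleton_self x) ?_)
      (singleton_subset_iff.2 (self_mem_cluster _ x))
    intro y hy z he
    rw [mem_singleton] at hy
    exact absurd hx (mem_compl.1 (hy ▸ (mk_mem_sym2_iff.1 (hB he)).1))
  have hout : Sᶜ.image (cluster (A ∪ B)) = Sᶜ.image (cluster B) :=
    image_congr fun x hx => cluster_union_right (by simpa using hx) hA hB
  have h1 : S.image (cluster (A ∪ B)) = {S} := by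
    rw [image_congr (g := fun _ => S) (fun x hx => hin x hx), image_const ⟨u, hu⟩]
  have h2 : #(S.image (cluster B)) = #S := by
    rw [card_image_of_injOn]
    intro x hx y hy hxy
    rw [hB' x hx, hB' y hy] at hxy
    exact singleton_injective hxy
  rw [card_image_cluster_split (A ∪ B) S fun x hx => (hin x hx).le, card_image_cluster_split B S,
    h1, h2, hout, card_singleton]
  · ring
  · exact fun x hx => by rw [hB' x hx]; exact singleton_subset_iff.2 hx

/-- The rank of the graphic matroid on an edge set. -/
noncomputable def edgeRank (A : Finset (Sym2 V)) : ℕ := Fintype.card V - numClusters A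

theorem edgeRank_insert_of_mem {A : Finset (Sym2 V)} {u v : V} (h : v ∈ cluster A u) :
    edgeRank (insert s(u, v) A) = edgeRank A := by
  rw [edgeRank, edgeRank, numClusters_insert_of_mem h]

theorem edgeRank_insert_of_notMem {A : Finset (Sym2 V)} {u v : V} (h : v ∉ cluster A u) :
    edgeRank (insert s(u, v) A) = edgeRank A + 1 := by
  have h1 := numClusters_insert_of_notMem h
  have h2 := numClusters_le A
  rw [edgeRank, edgeRank]
  omega

theorem edgeRank_union {A B : Finset (Sym2 V)} {S : Finset V} {u : V}
    (hA : A ⊆ S.sym2) (hB : B ⊆ Sᶜ.sym2) (hS : cluster A u = S) :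
    edgeRank (A ∪ B) = #S - 1 + edgeRank B := by
  have h1 := numClusters_union hA hB hS
  have h2 := numClusters_le B
  have h3 : 0 < #S := card_pos.2 ⟨u, hS ▸ self_mem_cluster A u⟩
  rw [edgeRank, edgeRank]
  omega

/-! ### Decomposition by the component of a vertex -/

/-- The subsets of `E` that span a connected graph with vertex set exactly `S`, where `u ∈ S`. -/
noncomputable def connectors (E : Finset (Sym2 V)) (u : V) (S : Finset V) :
    Finset (Finset (Sym2 V)) :=
  {A ∈ (E ∩ S.sym2).powerset | cluster A u = S}

theorem mem_connectors {E A : Finset (Sym2 V)} {u : V} {S : Finset V} :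
    A ∈ connectors E u S ↔ A ⊆ E ∩ S.sym2 ∧ cluster A u = S := by
  rw [connectors, mem_filter, mem_powerset]

theorem disjoint_sym2_compl (S : Finset V) : Disjoint S.sym2 Sᶜ.sym2 := by
  rw [disjoint_left]
  intro e
  induction e with
  | _ x y =>
    rw [mk_mem_sym2_iff, mk_mem_sym2_iff, mem_compl]
    tauto

theorem subset_sym2_union_of_cluster {A : Finset (Sym2 V)} {u : V} {S : Finset V}
    (h : cluster A u = S) : A ⊆ S.sym2 ∪ Sᶜ.sym2 := by
  intro e he
  induction e with
  | _ x y =>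
    rw [mem_union, mk_mem_sym2_iff, mk_mem_sym2_iff, mem_compl, mem_compl, ← h]
    have h1 : x ∈ cluster A u → y ∈ cluster A u := fun hx => mem_cluster_of_edge hx he
    have h2 : y ∈ cluster A u → x ∈ cluster A u :=
      fun hx => mem_cluster_of_edge hx (Sym2.eq_swap ▸ he)
    tauto

/-- Summing over edge sets by first fixing the component of `u`. -/
theorem sum_powerset_eq_sum_connectors {M : Type*} [AddCommMonoid M] (E : Finset (Sym2 V)) (u : V)
    (f : Finset (Sym2 V) → M) :
    ∑ A ∈ E.powerset, f A =
      ∑ S : Finset V, ∑ A ∈ connectors E u S, ∑ B ∈ (E ∩ Sᶜ.sym2).powerset, f (A ∪ B) := by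
  rw [← sum_fiberwise E.powerset (fun A => cluster A u) f]
  refine sum_congr rfl fun S _ => ?_
  rw [← sum_product']
  refine sum_nbij' (fun A => (A ∩ S.sym2, A ∩ Sᶜ.sym2)) (fun p => p.1 ∪ p.2) ?_ ?_ ?_ ?_ ?_
  · intro A hA
    simp only [mem_filter, mem_powerset] at hA
    have hu : u ∈ S := hA.2 ▸ self_mem_cluster A u
    have hAeq : A ∩ S.sym2 ∪ A ∩ Sᶜ.sym2 = A := by
      rw [← inter_union_distrib_left]
      exact inter_eq_left.2 (subset_sym2_union_of_cluster hA.2)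
    simp only [mem_product, mem_powerset, mem_connectors]
    refine ⟨⟨inter_subset_inter_right hA.1, ?_⟩, inter_subset_inter_right hA.1⟩
    rw [← cluster_union_left hu inter_subset_right (inter_subset_right (s₁ := A)), hAeq, hA.2]
  · rintro ⟨A, B⟩ hp
    simp only [mem_product, mem_powerset, mem_connectors] at hp
    obtain ⟨⟨hA, hS⟩, hB⟩ := hp
    have hu : u ∈ S := hS ▸ self_mem_cluster A u
    simp only [mem_filter, mem_powerset]
    refine ⟨union_subset (hA.trans inter_subset_left) (hB.trans inter_subset_left), ?_⟩
    rw [cluster_union_left hu (hA.trans inter_subset_right) (hB.trans inter_subset_right), hS]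
  · intro A hA
    simp only [mem_filter, mem_powerset] at hA
    simp only
    rw [← inter_union_distrib_left]
    exact inter_eq_left.2 (subset_sym2_union_of_cluster hA.2)
  · rintro ⟨A, B⟩ hp
    simp only [mem_product, mem_powerset, mem_connectors] at hp
    obtain ⟨⟨hA, hS⟩, hB⟩ := hp
    have hA' := hA.trans inter_subset_right
    have hB' := hB.trans inter_subset_right
    have hd := disjoint_sym2_compl S
    simp only [union_inter_distrib_right, Prod.mk.injEq]
    rw [inter_eq_left.2 hA', inter_eq_left.2 hB',
      disjoint_iff_inter_eq_empty.1 (hd.symm.mono_left hB'),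
      disjoint_iff_inter_eq_empty.1 (hd.mono_left hA'), union_empty, empty_union]
    exact ⟨rfl, rfl⟩
  · intro A hA
    simp only [mem_filter, mem_powerset] at hA
    simp only
    rw [← inter_union_distrib_left, inter_eq_left.2 (subset_sym2_union_of_cluster hA.2)]

/-- The signed count of connected spanning subgraphs of the graph induced on `S` (with `u ∈ S`). -/
noncomputable def connSum (E : Finset (Sym2 V)) (u : V) (S : Finset V) : ℂ :=
  ∑ A ∈ connectors E u S, (-1) ^ #A

theorem connSum_eq_sum_ite (E : Finset (Sym2 V)) (u : V) (S : Finset V) :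
    connSum E u S = ∑ A ∈ (E ∩ S.sym2).powerset, if cluster A u = S then (-1) ^ #A else 0 := by
  rw [connSum, connectors, sum_filter]

theorem connSum_congr {E E' : Finset (Sym2 V)} {S : Finset V} (h : E ∩ S.sym2 = E' ∩ S.sym2)
    (u : V) : connSum E u S = connSum E' u S := by
  rw [connSum, connSum, connectors, connectors, h]

/-- Lets later sums range over all `S`: the empty set, where the exponent `#S - 1` truncates,
contributes nothing. -/
theorem connSum_of_notMem (E : Finset (Sym2 V)) {u : V} {S : Finset V} (h : u ∉ S) :
    connSum E u S = 0 := by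
  rw [connSum_eq_sum_ite]
  exact sum_eq_zero fun A _ => if_neg fun (hc : cluster A u = S) => h (hc ▸ self_mem_cluster A u)

theorem connSum_insert_of_notMem (D : Finset (Sym2 V)) (u : V) {v : V} {S : Finset V}
    (hv : v ∉ S) : connSum (insert s(u, v) D) u S = connSum D u S := by
  refine connSum_congr ?_ u
  rw [insert_inter_of_notMem]
  simp [hv]

theorem card_union_of_sym2 {A B : Finset (Sym2 V)} {S : Finset V} (hA : A ⊆ S.sym2)
    (hB : B ⊆ Sᶜ.sym2) : #(A ∪ B) = #A + #B :=
  card_union_of_disjoint ((disjoint_sym2_compl S).mono hA hB)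

/-- If `A` already joins `u` to `v`, then `A` and `A` with the new edge cancel. What survives are
sets in which the edge is a bridge: `U` is the side of `u`, `S \ U` the side of `v`, and the sign
comes from the bridge. -/
theorem connSum_insert {D : Finset (Sym2 V)} {u v : V} {S : Finset V} (he : s(u, v) ∉ D)
    (hu : u ∈ S) (hv : v ∈ S) :
    connSum (insert s(u, v) D) u S =
      -∑ U ∈ S.powerset with v ∉ U, connSum D u U * connSum D v (S \ U) := by
  have heS : s(u, v) ∈ S.sym2 := mk_mem_sym2_iff.2 ⟨hu, hv⟩
  have step : connSum (insert s(u, v) D) u S = -∑ A ∈ (D ∩ S.sym2).powerset,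
      if v ∉ cluster A u ∧ cluster A u ∪ cluster A v = S then (-1 : ℂ) ^ #A else 0 := by
    rw [connSum_eq_sum_ite, insert_inter_of_mem heS,
      sum_powerset_insert (fun h => he (mem_inter.1 h).1), ← sum_add_distrib, ← sum_neg_distrib]
    refine sum_congr rfl fun A hA => ?_
    have heA : s(u, v) ∉ A := fun h => he (mem_inter.1 (mem_powerset.1 hA h)).1
    rw [card_insert_of_notMem heA, pow_succ]
    by_cases hvA : v ∈ cluster A u
    · rw [cluster_insert_of_mem hvA]
      simp only [hvA, not_true, false_and, if_false]
      split_ifs <;> simp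
    · have h1 : cluster A u ≠ S := fun h => hvA (h ▸ hv)
      rw [cluster_insert_left]
      simp only [hvA, not_false_eq_true, true_and, h1, if_false]
      split_ifs <;> simp
  rw [step, sum_powerset_eq_sum_connectors _ u, sum_filter,
    ← sum_subset (subset_univ S.powerset)]
  · congr 1
    refine sum_congr rfl fun U hU => ?_
    have hUS := mem_powerset.1 hU
    have hDU : D ∩ S.sym2 ∩ U.sym2 = D ∩ U.sym2 := by
      rw [inter_assoc, inter_eq_right.2 (sym2_mono hUS)]
    have hDU' : D ∩ S.sym2 ∩ Uᶜ.sym2 = D ∩ (S \ U).sym2 := by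
      ext e
      induction e with
      | _ x y => simp only [mem_inter, mk_mem_sym2_iff, mem_compl, mem_sdiff]; tauto
    have hc : connectors (D ∩ S.sym2) u U = connectors D u U := by
      rw [connectors, connectors, hDU]
    rw [hc, hDU']
    by_cases hvU : v ∉ U
    · rw [if_pos hvU, connSum, connSum_eq_sum_ite, sum_mul_sum]
      refine sum_congr rfl fun A hA => sum_congr rfl fun B hB => ?_
      obtain ⟨hA, hAU⟩ := mem_connectors.1 hA
      have hA' := hA.trans inter_subset_right
      have hB1 : B ⊆ (S \ U).sym2 := (mem_powerset.1 hB).trans inter_subset_right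
      have hB' : B ⊆ Uᶜ.sym2 :=
        hB1.trans (sym2_mono fun x hx => mem_compl.2 (mem_sdiff.1 hx).2)
      have huU : u ∈ U := hAU ▸ self_mem_cluster A u
      rw [cluster_union_left huU hA' hB', cluster_union_right hvU hA' hB', hAU,
        card_union_of_sym2 hA' hB', pow_add]
      have hBv : cluster B v ⊆ S \ U :=
        cluster_subset_of_subset_sym2 (mem_sdiff.2 ⟨hv, hvU⟩) hB1
      have hiff : (v ∉ U ∧ U ∪ cluster B v = S) ↔ cluster B v = S \ U := by
        constructor
        · rintro ⟨-, h⟩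
          refine Subset.antisymm hBv fun x hx => ?_
          have hx' := mem_sdiff.1 hx
          rw [← h] at hx'
          exact (mem_union.1 hx'.1).resolve_left hx'.2
        · intro h
          exact ⟨hvU, by rw [h, union_sdiff_of_subset hUS]⟩
      simp only [hiff]
      split_ifs <;> simp
    · rw [if_neg hvU]
      refine sum_eq_zero fun A hA => sum_eq_zero fun B hB => if_neg ?_
      rintro ⟨h, -⟩
      apply h
      exact cluster_mono subset_union_left u ((mem_connectors.1 hA).2 ▸ not_not.1 hvU)
  · intro U _ hU
    refine sum_eq_zero fun A hA => sum_eq_zero fun B hB => if_neg ?_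
    rintro ⟨-, h⟩
    apply hU
    rw [mem_powerset, ← (mem_connectors.1 hA).2, ← h]
    exact (cluster_mono subset_union_left u).trans subset_union_left

/-! ### Edge recursion for the normalised chromatic polynomial -/

/-- The chromatic polynomial of the graph with edge set `E`, normalised as a polynomial in
`q = 1 / x`. -/
noncomputable def rankSum (q : ℂ) (E : Finset (Sym2 V)) : ℂ :=
  ∑ A ∈ E.powerset, (-1) ^ #A * q ^ edgeRank A

theorem rankSum_empty (q : ℂ) : rankSum q (∅ : Finset (Sym2 V)) = 1 := by
  simp [rankSum, edgeRank, numClusters_empty]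

/-- Pair `A` with `A` plus the edge. The pair cancels if `A` joins `u` to `v`; otherwise the rank
rises by one and the pair gives a factor `1 - q`. The subtracted sum removes the joining `A`, sorted
by the component `S` of `u`. -/
theorem rankSum_insert (q : ℂ) {D : Finset (Sym2 V)} {u v : V} (he : s(u, v) ∉ D) :
    rankSum q (insert s(u, v) D) = (1 - q) * (rankSum q D -
      ∑ S with v ∈ S, connSum D u S * q ^ (#S - 1) * rankSum q (D ∩ Sᶜ.sym2)) := by
  have h1 : ∑ S with v ∈ S, connSum D u S * q ^ (#S - 1) * rankSum q (D ∩ Sᶜ.sym2) =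
      ∑ A ∈ D.powerset, if v ∈ cluster A u then (-1) ^ #A * q ^ edgeRank A else 0 := by
    rw [sum_powerset_eq_sum_connectors _ u, sum_filter]
    refine sum_congr rfl fun S _ => ?_
    have hAB : ∀ A ∈ connectors D u S, ∀ B ∈ (D ∩ Sᶜ.sym2).powerset,
        cluster (A ∪ B) u = S ∧ #(A ∪ B) = #A + #B ∧
          edgeRank (A ∪ B) = #S - 1 + edgeRank B := by
      intro A hA B hB
      obtain ⟨hA, hAS⟩ := mem_connectors.1 hA
      have hA' := hA.trans inter_subset_right
      have hB' := (mem_powerset.1 hB).trans inter_subset_right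
      refine ⟨?_, card_union_of_sym2 hA' hB', edgeRank_union hA' hB' hAS⟩
      rw [cluster_union_left (hAS ▸ self_mem_cluster A u) hA' hB', hAS]
    split_ifs with hv
    · rw [connSum, rankSum, sum_mul, sum_mul_sum]
      refine sum_congr rfl fun A hA => sum_congr rfl fun B hB => ?_
      obtain ⟨h1, h2, h3⟩ := hAB A hA B hB
      rw [h1, h2, h3, if_pos hv]
      ring
    · refine (sum_eq_zero fun A hA => sum_eq_zero fun B hB => ?_).symm
      rw [(hAB A hA B hB).1, if_neg hv]
  rw [h1, rankSum, rankSum, sum_powerset_insert he, ← sum_add_distrib, ← sum_sub_distrib, mul_sum]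
  refine sum_congr rfl fun A hA => ?_
  have heA : s(u, v) ∉ A := fun h => he (mem_powerset.1 hA h)
  rw [card_insert_of_notMem heA, pow_succ]
  by_cases hv : v ∈ cluster A u
  · rw [edgeRank_insert_of_mem hv, if_pos hv]
    ring
  · rw [edgeRank_insert_of_notMem hv, if_neg hv]
    ring

end Clusters

/-! ### Stars at a vertex -/

section Stars

open Finset

variable {V : Type*} [DecidableEq V]

/-- The edges joining `u` to the vertices of `N`. -/
def starEdges (u : V) (N : Finset V) : Finset (Sym2 V) := N.image fun v => s(u, v)

theorem mem_starEdges {u x y : V} {N : Finset V} :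
    s(x, y) ∈ starEdges u N ↔ x = u ∧ y ∈ N ∨ y = u ∧ x ∈ N := by
  simp only [starEdges, mem_image, Sym2.eq_iff]
  constructor
  · rintro ⟨v, hv, ⟨rfl, rfl⟩ | ⟨rfl, rfl⟩⟩
    · exact Or.inl ⟨rfl, hv⟩
    · exact Or.inr ⟨rfl, hv⟩
  · rintro (⟨rfl, h⟩ | ⟨rfl, h⟩)
    · exact ⟨y, h, Or.inl ⟨rfl, rfl⟩⟩
    · exact ⟨x, h, Or.inr ⟨rfl, rfl⟩⟩

theorem union_starEdges_insert (D : Finset (Sym2 V)) (u v : V) (N : Finset V) :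
    D ∪ starEdges u (insert v N) = insert s(u, v) (D ∪ starEdges u N) := by
  rw [starEdges, image_insert, union_insert, starEdges]

theorem union_starEdges_inter_sym2 (D : Finset (Sym2 V)) {u : V} {X : Finset V} (hu : u ∉ X)
    (N : Finset V) : (D ∪ starEdges u N) ∩ X.sym2 = D ∩ X.sym2 := by
  ext e
  induction e with
  | _ x y =>
    simp only [mem_inter, mem_union, mem_starEdges, mk_mem_sym2_iff]
    constructor
    · rintro ⟨h | ⟨rfl, -⟩ | ⟨rfl, -⟩, hx, hy⟩
      · exact ⟨h, hx, hy⟩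
      · exact absurd hx hu
      · exact absurd hy hu
    · rintro ⟨h, hx⟩
      exact ⟨Or.inl h, hx⟩

theorem edge_notMem_union_starEdges {D : Finset (Sym2 V)} {u v : V} {X N : Finset V}
    (hD : D ⊆ X.sym2) (hu : u ∉ X) (huN : u ∉ N) (hv : v ∉ N) : s(u, v) ∉ D ∪ starEdges u N := by
  rw [mem_union, mem_starEdges]
  rintro (h | ⟨-, h⟩ | ⟨-, h⟩)
  · exact hu (mk_mem_sym2_iff.1 (hD h)).1
  · exact hv h
  · exact huN h

theorem inter_sym2_insert {E : Finset (Sym2 V)} {u : V} (X : Finset V) (hE : s(u, u) ∉ E) :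
    E ∩ (insert u X).sym2 = E ∩ X.sym2 ∪ starEdges u {v ∈ X | s(u, v) ∈ E} := by
  ext e
  induction e with
  | _ x y =>
    have hswap : s(x, y) ∈ E ↔ s(y, x) ∈ E := by rw [Sym2.eq_swap]
    simp only [mem_inter, mem_union, mem_starEdges, mk_mem_sym2_iff, mem_insert, mem_filter]
    constructor
    · rintro ⟨h, rfl | hx, rfl | hy⟩
      · exact absurd h hE
      · exact Or.inr (Or.inl ⟨rfl, hy, h⟩)
      · exact Or.inr (Or.inr ⟨rfl, hx, hswap.1 h⟩)
      · exact Or.inl ⟨h, hx, hy⟩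
    · rintro (⟨h, hx, hy⟩ | ⟨rfl, hy, h⟩ | ⟨rfl, hx, h⟩)
      · exact ⟨h, Or.inr hx, Or.inr hy⟩
      · exact ⟨h, Or.inl rfl, Or.inr hy⟩
      · exact ⟨hswap.2 h, Or.inr hx, Or.inl rfl⟩

end Stars

/-! ### Weighted counts of connected sets -/

section Weights

open Finset

variable {V : Type*} [Fintype V] [DecidableEq V]

/-- The weighted number of connected vertex sets containing `u` and `w`. -/
noncomputable def connWeight (c : ℝ) (D : Finset (Sym2 V)) (u w : V) : ℝ :=
  ∑ S with w ∈ S, ‖connSum D u S‖ * c ^ (#S - 1)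

theorem connWeight_nonneg {c : ℝ} (hc : 0 ≤ c) (D : Finset (Sym2 V)) (u w : V) :
    0 ≤ connWeight c D u w :=
  sum_nonneg fun _ _ => by positivity

theorem connWeight_self (c : ℝ) (D : Finset (Sym2 V)) (u : V) :
    connWeight c D u u = ∑ S, ‖connSum D u S‖ * c ^ (#S - 1) := by
  rw [connWeight, sum_filter]
  refine sum_congr rfl fun S _ => ?_
  split_ifs with h
  · rfl
  · simp [connSum_of_notMem D h]

theorem connSum_inter_compl_singleton (D : Finset (Sym2 V)) {u : V} (v : V) {S : Finset V}
    (h : u ∉ S) : connSum (D ∩ ({u}ᶜ : Finset V).sym2) v S = connSum D v S := by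
  refine connSum_congr ?_ v
  rw [inter_assoc, inter_eq_right.2 (sym2_mono fun x hx => ?_)]
  simp only [mem_compl, mem_singleton]
  rintro rfl
  exact h hx

/-- The bridge recursion in absolute values; the bridge carries the extra `c`. As `u` lies in `U`,
the factor for `S \ U` does not see `u`, which may be deleted there. -/
theorem norm_connSum_insert_le {c : ℝ} (hc : 0 ≤ c) {D : Finset (Sym2 V)} {u v : V}
    (he : s(u, v) ∉ D) (S : Finset V) :
    ‖connSum (insert s(u, v) D) u S‖ * c ^ (#S - 1) ≤ ‖connSum D u S‖ * c ^ (#S - 1) +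
      ∑ U ∈ S.powerset, c * (‖connSum D u U‖ * c ^ (#U - 1)) *
        (‖connSum (D ∩ ({u}ᶜ : Finset V).sym2) v (S \ U)‖ * c ^ (#(S \ U) - 1)) := by
  have hnn : ∀ U : Finset V, 0 ≤ c * (‖connSum D u U‖ * c ^ (#U - 1)) *
        (‖connSum (D ∩ ({u}ᶜ : Finset V).sym2) v (S \ U)‖ * c ^ (#(S \ U) - 1)) :=
    fun U => by positivity
  by_cases hv : v ∈ S
  swap
  · rw [connSum_insert_of_notMem D u hv]
    exact le_add_of_nonneg_right (sum_nonneg fun U _ => hnn U)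
  by_cases hu : u ∈ S
  swap
  · rw [connSum_of_notMem _ hu, norm_zero, zero_mul]
    exact add_nonneg (by positivity) (sum_nonneg fun U _ => hnn U)
  refine le_add_of_nonneg_of_le (by positivity) ?_
  rw [connSum_insert he hu hv, norm_neg]
  refine (mul_le_mul_of_nonneg_right (norm_sum_le _ _) (by positivity)).trans ?_
  rw [sum_mul, sum_filter]
  refine sum_le_sum fun U hU => ?_
  by_cases hvU : v ∈ U
  · rw [if_neg (not_not.2 hvU)]
    exact hnn U
  rw [if_pos hvU]
  by_cases huU : u ∈ U
  swap
  · rw [connSum_of_notMem _ huU]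
    simp
  have hUS := mem_powerset.1 hU
  rw [connSum_inter_compl_singleton D v (by simp [huU]), norm_mul]
  have h1 : 0 < #U := card_pos.2 ⟨u, huU⟩
  have h2 : 0 < #(S \ U) := card_pos.2 ⟨v, mem_sdiff.2 ⟨hv, hvU⟩⟩
  have h3 := card_sdiff_add_card_eq_card hUS
  have h4 : #S - 1 = 1 + (#U - 1) + (#(S \ U) - 1) := by omega
  rw [h4, pow_add, pow_add, pow_one]
  exact le_of_eq (by ring)

/-- For fixed `U`, the set `W = S \ U` determines `S`, and `w` lies in `U` or in `W`. Dropping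
disjointness of `U` and `W` only enlarges the right side. -/
theorem sum_powerset_sdiff_le {F : Finset V → Finset V → ℝ} (hF : ∀ U W, 0 ≤ F U W) (w : V) :
    ∑ S with w ∈ S, ∑ U ∈ S.powerset, F U (S \ U) ≤
      ∑ U with w ∈ U, ∑ W, F U W + ∑ U, ∑ W with w ∈ W, F U W := by
  have h1 : ∑ S with w ∈ S, ∑ U ∈ S.powerset, F U (S \ U) =
      ∑ U, ∑ S with w ∈ S ∧ U ⊆ S, F U (S \ U) := by
    rw [sum_filter]
    simp_rw [sum_filter]
    rw [sum_comm]
    refine sum_congr rfl fun S _ => ?_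
    by_cases hw : w ∈ S
    · simp only [hw, true_and, if_true]
      rw [← sum_filter]
      exact sum_congr (by ext; simp) fun _ _ => rfl
    · simp [hw]
  rw [h1, sum_filter, ← sum_add_distrib]
  refine sum_le_sum fun U _ => ?_
  have hinj : Set.InjOn (fun S : Finset V => S \ U)
      (({S | w ∈ S ∧ U ⊆ S} : Finset (Finset V)) : Set (Finset V)) := by
    intro S hS T hT hST
    simp only [coe_filter, mem_univ, true_and, Set.mem_ofPred_eq] at hS hT hST
    rw [← union_sdiff_of_subset hS.2, hST, union_sdiff_of_subset hT.2]
  rw [← sum_image (f := fun W => F U W) hinj]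
  split_ifs with hw
  · refine le_add_of_le_of_nonneg ?_ (sum_nonneg fun W _ => hF U W)
    exact sum_le_sum_of_subset_of_nonneg (subset_univ _) fun W _ _ => hF U W
  · rw [zero_add]
    refine sum_le_sum_of_subset_of_nonneg ?_ fun W _ _ => hF U W
    intro W hW
    obtain ⟨S, hS, rfl⟩ := mem_image.1 hW
    simp only [mem_filter, mem_univ, true_and] at hS
    simp [hS.1, hw]

theorem connWeight_insert_le {c : ℝ} (hc : 0 ≤ c) {D : Finset (Sym2 V)} {u v : V}
    (he : s(u, v) ∉ D) (w : V) :
    connWeight c (insert s(u, v) D) u w ≤ connWeight c D u w +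
      c * (connWeight c D u w * connWeight c (D ∩ ({u}ᶜ : Finset V).sym2) v v +
        connWeight c D u u * connWeight c (D ∩ ({u}ᶜ : Finset V).sym2) v w) := by
  have h1 := sum_le_sum fun (S : Finset V) (_ : S ∈ ({S | w ∈ S} : Finset (Finset V))) =>
    norm_connSum_insert_le hc he S
  rw [sum_add_distrib] at h1
  have h2 := sum_powerset_sdiff_le (F := fun U W => c * (‖connSum D u U‖ * c ^ (#U - 1)) *
    (‖connSum (D ∩ ({u}ᶜ : Finset V).sym2) v W‖ * c ^ (#W - 1)))
    (fun U W => by positivity) w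
  refine h1.trans (add_le_add le_rfl (h2.trans (le_of_eq ?_)))
  rw [mul_add, connWeight_self, connWeight_self]
  unfold connWeight
  rw [sum_mul_sum, sum_mul_sum, mul_sum, mul_sum]
  simp only [mul_sum, mul_assoc]

theorem cluster_of_isolated {A : Finset (Sym2 V)} {u : V} {X : Finset V} (hA : A ⊆ X.sym2)
    (hu : u ∉ X) : cluster A u = {u} := by
  refine Subset.antisymm (cluster_subset_of_closed (mem_singleton_self u) ?_)
    (singleton_subset_iff.2 (self_mem_cluster _ u))
  intro x hx y he
  rw [mem_singleton] at hx
  exact absurd (hx ▸ (mk_mem_sym2_iff.1 (hA he)).1) hu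

theorem connWeight_to_isolated (c : ℝ) {D : Finset (Sym2 V)} {u v : V} {X : Finset V}
    (hD : D ⊆ X.sym2) (hu : u ∉ X) (hv : v ≠ u) : connWeight c D v u = 0 := by
  refine sum_eq_zero fun S hS => ?_
  rw [connSum_eq_sum_ite, sum_eq_zero, norm_zero, zero_mul]
  intro A hA
  refine if_neg fun h => hv ?_
  have h1 : u ∈ cluster A v := h ▸ (mem_filter.1 hS).2
  rw [mem_cluster_comm, cluster_of_isolated
    (((mem_powerset.1 hA).trans inter_subset_left).trans hD) hu] at h1
  exact mem_singleton.1 h1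

theorem connWeight_of_isolated (c : ℝ) {D : Finset (Sym2 V)} {u : V} {X : Finset V}
    (hD : D ⊆ X.sym2) (hu : u ∉ X) (w : V) :
    connWeight c D u w = if w = u then 1 else 0 := by
  have h0 : ∀ S, S ≠ {u} → connSum D u S = 0 := by
    intro S hS
    rw [connSum_eq_sum_ite]
    refine sum_eq_zero fun A hA => if_neg fun h => hS ?_
    rw [← h, cluster_of_isolated (((mem_powerset.1 hA).trans inter_subset_left).trans hD) hu]
  have h1 : connSum D u {u} = 1 := by
    have : D ∩ ({u} : Finset V).sym2 = ∅ := by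
      rw [eq_empty_iff_forall_notMem]
      intro e he
      induction e with
      | _ x y =>
        rw [mem_inter, mk_mem_sym2_iff, mem_singleton] at he
        exact hu (he.2.1 ▸ (mk_mem_sym2_iff.1 (hD he.1)).1)
    rw [connSum_eq_sum_ite, this]
    simp [cluster_empty]
  rw [connWeight, sum_filter, sum_eq_single {u}]
  · simp [h1]
  · intro S _ hS
    simp [h0 S hS]
  · simp

/-- Initially `u` is isolated. Deleting `u` after any number of star edges gives back `D`, so each
new edge multiplies the existing weight by at most `1 + c * b` and opens one new route to `w`
through its endpoint. -/
theorem connWeight_star_le {b c : ℝ} (hc : 0 ≤ c) {D : Finset (Sym2 V)} {u : V} {X : Finset V}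
    (hD : D ⊆ X.sym2) (hu : u ∉ X) (N : Finset V) (huN : u ∉ N)
    (hN : ∀ v ∈ N, connWeight c D v v ≤ b) :
    connWeight c (D ∪ starEdges u N) u u ≤ (1 + c * b) ^ #N ∧
      ∀ w, w ≠ u → connWeight c (D ∪ starEdges u N) u w ≤
        (1 + c * b) ^ #N * (c * ∑ v ∈ N, connWeight c D v w) := by
  induction N using Finset.induction_on with
  | empty =>
    simp only [starEdges, image_empty, union_empty, card_empty, pow_zero, sum_empty, mul_zero]
    refine ⟨by rw [connWeight_of_isolated c hD hu, if_pos rfl], fun w hw => ?_⟩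
    rw [connWeight_of_isolated c hD hu, if_neg hw]
  | insert v N hv ih =>
    have huN' : u ∉ N := fun h => huN (mem_insert_of_mem h)
    obtain ⟨ih1, ih2⟩ := ih huN' fun x hx => hN x (mem_insert_of_mem hx)
    have hvb := hN v (mem_insert_self v N)
    have hb : 0 ≤ b := (connWeight_nonneg hc D v v).trans hvb
    have hD' : (D ∪ starEdges u N) ∩ ({u}ᶜ : Finset V).sym2 = D := by
      rw [union_starEdges_inter_sym2 D (by simp), inter_eq_left]
      refine hD.trans (sym2_mono fun x hx => ?_)
      simp only [mem_compl, mem_singleton]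
      rintro rfl
      exact hu hx
    have key := fun w => connWeight_insert_le hc
      (edge_notMem_union_starEdges hD hu huN' hv) w
    rw [hD'] at key
    rw [union_starEdges_insert, card_insert_of_notMem hv, pow_succ]
    have hP : 0 ≤ (1 + c * b) ^ #N := by positivity
    have hcb : 0 ≤ c * b := by positivity
    have hvu : v ≠ u := fun h => huN (h ▸ mem_insert_self v N)
    have hnn := fun x => connWeight_nonneg hc (D ∪ starEdges u N) u x
    refine ⟨(key u).trans ?_, fun w hw => (key w).trans ?_⟩
    · rw [connWeight_to_isolated c hD hu hvu, mul_zero, add_zero]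
      calc _ ≤ connWeight c (D ∪ starEdges u N) u u +
            c * (connWeight c (D ∪ starEdges u N) u u * b) := by
            have := hnn u
            gcongr
        _ = connWeight c (D ∪ starEdges u N) u u * (1 + c * b) := by ring
        _ ≤ _ := by gcongr
    · have h2 := connWeight_nonneg hc D v w
      have h3 := hnn w
      rw [sum_insert hv]
      calc _ ≤ connWeight c (D ∪ starEdges u N) u w +
            c * (connWeight c (D ∪ starEdges u N) u w * b +
              (1 + c * b) ^ #N * connWeight c D v w) := by gcongr
        _ = connWeight c (D ∪ starEdges u N) u w * (1 + c * b) +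
              (1 + c * b) ^ #N * (c * connWeight c D v w) * 1 := by ring
        _ ≤ (1 + c * b) ^ #N * (c * ∑ v ∈ N, connWeight c D v w) * (1 + c * b) +
              (1 + c * b) ^ #N * (c * connWeight c D v w) * (1 + c * b) := by
            gcongr
            · exact ih2 w hw
            · linarith
        _ = _ := by ring

theorem connWeight_self_le {b c : ℝ} {d : ℕ} (hc : 0 ≤ c) (hb : 0 ≤ b)
    (hcb : (1 + c * b) ^ d ≤ b) {E : Finset (Sym2 V)} (hE : ∀ v, s(v, v) ∉ E)
    (hdeg : ∀ v, #{w | s(v, w) ∈ E} ≤ d) (X : Finset V) (u : V) (hu : u ∈ X) :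
    connWeight c (E ∩ X.sym2) u u ≤ b := by
  induction X using Finset.strongInduction generalizing u with
  | _ X ih =>
    rw [← insert_erase hu, inter_sym2_insert _ (hE u)]
    have h1 := (connWeight_star_le (b := b) hc (inter_subset_right (s₁ := E)) (notMem_erase u X)
      {v ∈ X.erase u | s(u, v) ∈ E} (by simp)
      fun v hv => ih _ (erase_ssubset hu) v (mem_filter.1 hv).1).1
    have hcb0 : 0 ≤ c * b := by positivity
    refine h1.trans ((pow_le_pow_right₀ (by linarith) ?_).trans hcb)
    exact (card_le_card (filter_subset_filter _ (subset_univ _))).trans (hdeg u)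

/-! ### Comparison with walks -/

/-- The 0-1 adjacency matrix of an edge set. -/
def edgeMatrix (E : Finset (Sym2 V)) : Matrix V V ℝ :=
  Matrix.of fun v w => if s(v, w) ∈ E then 1 else 0

theorem edgeMatrix_pow_nonneg (E : Finset (Sym2 V)) (k : ℕ) (u w : V) :
    0 ≤ (edgeMatrix E ^ k) u w := by
  induction k generalizing u with
  | zero => rw [pow_zero, Matrix.one_apply]; split_ifs <;> norm_num
  | succ k ih =>
    rw [pow_succ', Matrix.mul_apply]
    refine sum_nonneg fun v _ => mul_nonneg ?_ (ih v)
    rw [edgeMatrix, Matrix.of_apply]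
    split_ifs <;> norm_num

theorem edgeMatrix_pow_symm (E : Finset (Sym2 V)) (k : ℕ) (u w : V) :
    (edgeMatrix E ^ k) u w = (edgeMatrix E ^ k) w u := by
  have h : (edgeMatrix E).transpose = edgeMatrix E := by
    ext v w
    simp [edgeMatrix, Sym2.eq_swap]
  have h2 := congrFun (congrFun (Matrix.transpose_pow (edgeMatrix E) k) w) u
  rwa [h, Matrix.transpose_apply] at h2

theorem sum_edgeMatrix_pow_le {E : Finset (Sym2 V)} {d : ℕ}
    (hdeg : ∀ v, #{w | s(v, w) ∈ E} ≤ d) (k : ℕ) (u : V) :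
    ∑ w, (edgeMatrix E ^ k) u w ≤ (d : ℝ) ^ k := by
  induction k generalizing u with
  | zero => simp [Matrix.one_apply]
  | succ k ih =>
    simp only [pow_succ', Matrix.mul_apply]
    rw [sum_comm]
    simp only [← mul_sum]
    calc _ ≤ ∑ v, edgeMatrix E u v * (d : ℝ) ^ k := by
          refine sum_le_sum fun v _ => mul_le_mul_of_nonneg_left (ih v) ?_
          simpa using edgeMatrix_pow_nonneg E 1 u v
      _ = (#{w | s(u, w) ∈ E} : ℝ) * (d : ℝ) ^ k := by
          rw [← sum_mul]
          simp [edgeMatrix]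
      _ ≤ _ := by
          gcongr
          exact hdeg u

/-- Iterating the star bound expands the weight along walks from `u` to `w`, each step costing `c *
b`. A vertex is deleted at each step, so the lengths stay below `#X`. -/
theorem connWeight_le_sum_walks {b c : ℝ} {d : ℕ} (hc : 0 ≤ c) (hb : 0 ≤ b)
    (hcb : (1 + c * b) ^ d ≤ b) {E : Finset (Sym2 V)} (hE : ∀ v, s(v, v) ∉ E)
    (hdeg : ∀ v, #{w | s(v, w) ∈ E} ≤ d) (X : Finset V) (u : V) (hu : u ∈ X) (w : V) :
    connWeight c (E ∩ X.sym2) u w ≤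
      b * ∑ k ∈ range #X, (c * b) ^ k * (edgeMatrix E ^ k) u w := by
  have hcb0 : 0 ≤ c * b := by positivity
  have hterm : ∀ (k : ℕ) (v : V), 0 ≤ (c * b) ^ k * (edgeMatrix E ^ k) v w := fun k v =>
    mul_nonneg (by positivity) (edgeMatrix_pow_nonneg E k v w)
  induction X using Finset.strongInduction generalizing u with
  | _ X ih =>
    by_cases hw : w = u
    · subst hw
      refine (connWeight_self_le hc hb hcb hE hdeg X w hu).trans (le_mul_of_one_le_right hb ?_)
      -- The walk of length zero already accounts for the diagonal bound `b`.
      have h0 : 0 ∈ range #X := mem_range.2 (card_pos.2 ⟨w, hu⟩)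
      refine le_trans ?_ (single_le_sum (fun k _ => hterm k w) h0)
      simp
    · have hX : #X = #(X.erase u) + 1 := (card_erase_add_one hu).symm
      have h1 := (connWeight_star_le (b := b) hc (inter_subset_right (s₁ := E)) (notMem_erase u X)
        {v ∈ X.erase u | s(u, v) ∈ E} (by simp)
        fun v hv => connWeight_self_le hc hb hcb hE hdeg _ v (mem_filter.1 hv).1).2 w hw
      rw [← inter_sym2_insert _ (hE u), insert_erase hu] at h1
      set N : Finset V := {v ∈ X.erase u | s(u, v) ∈ E} with hN
      have hNd : (1 + c * b) ^ #N ≤ b := by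
        refine (pow_le_pow_right₀ (by linarith) ?_).trans hcb
        exact (card_le_card (filter_subset_filter _ (subset_univ _))).trans (hdeg u)
      have h2 : ∑ v ∈ N, connWeight c (E ∩ (X.erase u).sym2) v w ≤
          b * ∑ k ∈ range #(X.erase u), (c * b) ^ k * (edgeMatrix E ^ (k + 1)) u w := by
        calc _ ≤ ∑ v ∈ N, b * ∑ k ∈ range #(X.erase u), (c * b) ^ k * (edgeMatrix E ^ k) v w :=
              sum_le_sum fun v hv => ih _ (erase_ssubset hu) v (mem_filter.1 hv).1
          _ ≤ ∑ v with s(u, v) ∈ E,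
                b * ∑ k ∈ range #(X.erase u), (c * b) ^ k * (edgeMatrix E ^ k) v w := by
              refine sum_le_sum_of_subset_of_nonneg
                (filter_subset_filter _ (subset_univ _)) fun v _ _ => ?_
              exact mul_nonneg hb (sum_nonneg fun k _ => hterm k v)
          _ = _ := by
              rw [← mul_sum, sum_comm]
              congr 1
              refine sum_congr rfl fun k _ => ?_
              rw [← mul_sum, pow_succ', Matrix.mul_apply, sum_filter]
              simp [edgeMatrix]
      refine h1.trans ?_
      rw [hX, sum_range_succ']
      calc _ ≤ b * (c * (b * ∑ k ∈ range #(X.erase u),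
              (c * b) ^ k * (edgeMatrix E ^ (k + 1)) u w)) := by
            have := sum_nonneg fun v (_ : v ∈ N) =>
              connWeight_nonneg hc (E ∩ (X.erase u).sym2) v w
            gcongr
        _ = b * ∑ k ∈ range #(X.erase u), (c * b) ^ (k + 1) * (edgeMatrix E ^ (k + 1)) u w := by
            rw [mul_sum, mul_sum]
            congr 1
            refine (sum_congr rfl fun k _ => ?_)
            ring
        _ ≤ _ := by
            gcongr
            exact le_add_of_nonneg_right (hterm 0 u)

end Weights

/-! ### The zero-free induction -/

section Zeros

open Finset

variable {V : Type*} [Fintype V] [DecidableEq V]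

theorem norm_one_sub_pow_sub_one_le (q : ℂ) (n : ℕ) :
    ‖(1 - q) ^ n - 1‖ ≤ (1 + ‖q‖) ^ n - 1 := by
  induction n with
  | zero => simp
  | succ n ih =>
    have h1 : (1 - q) ^ (n + 1) - 1 = (1 - q) * ((1 - q) ^ n - 1) - q := by ring
    have h2 : ‖1 - q‖ ≤ 1 + ‖q‖ := (norm_sub_le _ _).trans (by simp)
    calc _ ≤ ‖1 - q‖ * ‖(1 - q) ^ n - 1‖ + ‖q‖ := by
          rw [h1, ← norm_mul]
          exact norm_sub_le _ _
      _ ≤ (1 + ‖q‖) * ((1 + ‖q‖) ^ n - 1) + ‖q‖ := by gcongr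
      _ = _ := by ring

/-- Attaching the edge to `w` costs the weight from `u` to `w`, which passes through the neighbours
attached earlier. Each unordered pair of neighbours is thus charged once; the symmetry of `M` turns
this into half the double sum. -/
theorem norm_rankSum_star_sub_le {b c r : ℝ} {q : ℂ} (hr : 0 ≤ r) (hc : c = ‖q‖ * r)
    (hb : 0 ≤ b) (hq : ‖1 - q‖ ≤ 1 + c * b) {D : Finset (Sym2 V)} {u : V} {X : Finset V}
    (hD : D ⊆ X.sym2) (hu : u ∉ X)
    (hR : ∀ S : Finset V, u ∈ S →
      ‖rankSum q (D ∩ Sᶜ.sym2)‖ ≤ ‖rankSum q D‖ * r ^ (#S - 1))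
    {M : V → V → ℝ} (hM0 : ∀ v w, 0 ≤ M v w) (hMs : ∀ v w, M v w = M w v)
    (N : Finset V) (huN : u ∉ N) (hN : ∀ v ∈ N, connWeight c D v v ≤ b)
    (hM : ∀ v ∈ N, ∀ w ∈ N, v ≠ w → connWeight c D v w ≤ M v w) :
    ‖rankSum q (D ∪ starEdges u N) - (1 - q) ^ #N * rankSum q D‖ ≤
      ‖rankSum q D‖ * ((1 + c * b) ^ #N * (c / 2 * ∑ v ∈ N, ∑ w ∈ N, M v w)) := by
  have hc0 : 0 ≤ c := hc ▸ by positivity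
  have hcb : 0 ≤ c * b := by positivity
  induction N using Finset.induction_on with
  | empty => simp [starEdges]
  | insert w N hw ih =>
    have huN' : u ∉ N := fun h => huN (mem_insert_of_mem h)
    have hN' : ∀ v ∈ N, connWeight c D v v ≤ b := fun x hx => hN x (mem_insert_of_mem hx)
    have ih := ih huN' hN' fun v hv w hw =>
      hM v (mem_insert_of_mem hv) w (mem_insert_of_mem hw)
    have hwu : w ≠ u := fun h => huN (h ▸ mem_insert_self w N)
    have ht : connWeight c (D ∪ starEdges u N) u w ≤
        (1 + c * b) ^ #N * (c * ∑ v ∈ N, M v w) := by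
      refine ((connWeight_star_le hc0 hD hu N huN' hN').2 w hwu).trans ?_
      gcongr with v hv
      exact hM v (mem_insert_of_mem hv) w (mem_insert_self w N) fun h => hw (h ▸ hv)
    rw [union_starEdges_insert, card_insert_of_notMem hw,
      rankSum_insert q (edge_notMem_union_starEdges hD hu huN' hw)]
    set R := ∑ S with w ∈ S, connSum (D ∪ starEdges u N) u S * q ^ (#S - 1) *
      rankSum q ((D ∪ starEdges u N) ∩ Sᶜ.sym2) with hRdef
    have hRle : ‖R‖ ≤ ‖rankSum q D‖ * ((1 + c * b) ^ #N * (c * ∑ v ∈ N, M v w)) := by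
      refine le_trans ?_ (mul_le_mul_of_nonneg_left ht (norm_nonneg _))
      rw [connWeight, mul_sum]
      refine norm_sum_le_of_le _ fun S _ => ?_
      by_cases huS : u ∈ S
      · rw [union_starEdges_inter_sym2 D (by simpa using huS), norm_mul, norm_mul, norm_pow, hc,
          mul_pow]
        calc _ ≤ ‖connSum (D ∪ starEdges u N) u S‖ * ‖q‖ ^ (#S - 1) *
              (‖rankSum q D‖ * r ^ (#S - 1)) := by
              gcongr
              exact hR S huS
          _ = _ := by ring
      · simp [connSum_of_notMem _ huS]
    have hsum : ∑ v ∈ insert w N, ∑ x ∈ insert w N, M v x =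
        M w w + 2 * ∑ v ∈ N, M v w + ∑ v ∈ N, ∑ x ∈ N, M v x := by
      rw [sum_insert hw, sum_insert hw]
      simp only [sum_insert hw, sum_add_distrib]
      rw [sum_congr rfl fun x _ => hMs w x]
      ring
    have hsplit : (1 - q) * (rankSum q (D ∪ starEdges u N) - R) -
        (1 - q) ^ (#N + 1) * rankSum q D = (1 - q) *
        ((rankSum q (D ∪ starEdges u N) - (1 - q) ^ #N * rankSum q D) - R) := by ring
    rw [hsplit, norm_mul, hsum]
    calc _ ≤ (1 + c * b) *
          (‖rankSum q D‖ * ((1 + c * b) ^ #N * (c / 2 * ∑ v ∈ N, ∑ w ∈ N, M v w)) +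
          ‖rankSum q D‖ * ((1 + c * b) ^ #N * (c * ∑ v ∈ N, M v w))) := by
          gcongr
          exact (norm_sub_le _ _).trans (add_le_add ih hRle)
      _ = ‖rankSum q D‖ * ((1 + c * b) ^ (#N + 1) * (c / 2 *
          (0 + 2 * ∑ v ∈ N, M v w + ∑ v ∈ N, ∑ w ∈ N, M v w))) := by ring
      _ ≤ _ := by
          gcongr
          -- The diagonal entry is never charged; its nonnegativity allows the full square sum.
          exact hM0 w w

theorem norm_rankSum_sdiff_le {a : ℝ} (ha : a < 1) {q : ℂ} {E : Finset (Sym2 V)} {Y : Finset V}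
    (h : ∀ Z ⊆ Y, ∀ u ∈ Z, (1 - a) * ‖rankSum q (E ∩ (Z.erase u).sym2)‖ ≤
      ‖rankSum q (E ∩ Z.sym2)‖) (T : Finset V) (hT : T ⊆ Y) :
    ‖rankSum q (E ∩ (Y \ T).sym2)‖ ≤ ‖rankSum q (E ∩ Y.sym2)‖ * (1 - a)⁻¹ ^ #T := by
  induction T using Finset.induction_on with
  | empty => simp
  | insert x T hx ih =>
    have h1 := ih fun y hy => hT (mem_insert_of_mem hy)
    have h2 := h (Y \ T) sdiff_subset x (mem_sdiff.2 ⟨hT (mem_insert_self x T), hx⟩)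
    have ha' : 0 < 1 - a := by linarith
    rw [sdiff_insert, card_insert_of_notMem hx, pow_succ, ← mul_assoc,
      ← div_eq_mul_inv _ (1 - a), le_div_iff₀ ha']
    linarith

/-- Nonvanishing and the ratio bound must be proved together: the ratio bound on smaller sets
controls the corrections that arise when a vertex is added. -/
theorem rankSum_ne_zero_and_le {a b L : ℝ} {d m : ℕ} {q : ℂ} (ha : 0 ≤ a) (ha1 : a < 1)
    (hL : L < 1) (hcb : (1 + ‖q‖ * (1 - a)⁻¹ * b) ^ d ≤ b) (hcd : ‖q‖ * (1 - a)⁻¹ * b * d ≤ L)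
    (hb : 0 ≤ b)
    (hab : (1 + ‖q‖) ^ d - 1 + b * L ^ (m + 1) / (2 * (1 - L)) ≤ a)
    {E : Finset (Sym2 V)} (hE : ∀ v, s(v, v) ∉ E) (hdeg : ∀ v, #{w | s(v, w) ∈ E} ≤ d)
    (hg : ∀ (X : Finset V), ∀ u ∉ X, ∀ v w, s(u, v) ∈ E → s(u, w) ∈ E → v ≠ w → ∀ k < m,
      (edgeMatrix (E ∩ X.sym2) ^ k) v w = 0) (X : Finset V) :
    rankSum q (E ∩ X.sym2) ≠ 0 ∧
      ∀ u ∈ X, (1 - a) * ‖rankSum q (E ∩ (X.erase u).sym2)‖ ≤ ‖rankSum q (E ∩ X.sym2)‖ := by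
  have ha' : 0 < 1 - a := by linarith
  set c := ‖q‖ * (1 - a)⁻¹ with hc
  have hc0 : 0 ≤ c := by positivity
  have hcb0 : 0 ≤ c * b := by positivity
  have hL0 : 0 ≤ L := le_trans (by positivity) hcd
  have hb1 : 1 ≤ b := (one_le_pow₀ (by linarith)).trans hcb
  have hinv : 1 ≤ (1 - a)⁻¹ := (one_le_inv₀ ha').2 (by linarith)
  have hq : ‖1 - q‖ ≤ 1 + c * b := by
    refine (norm_sub_le _ _).trans ?_
    rw [norm_one]
    have : ‖q‖ * 1 * 1 ≤ ‖q‖ * (1 - a)⁻¹ * b := by gcongr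
    linarith
  induction X using Finset.strongInduction with
  | _ X ih =>
  have key : ∀ u ∈ X,
      (1 - a) * ‖rankSum q (E ∩ (X.erase u).sym2)‖ ≤ ‖rankSum q (E ∩ X.sym2)‖ := by
    intro u hu
    set Y := X.erase u with hY
    set D := E ∩ Y.sym2 with hD
    have hDE : D ⊆ E := inter_subset_left
    have hDD : D ∩ Y.sym2 = D := inter_eq_left.2 inter_subset_right
    have huY : u ∉ Y := notMem_erase u X
    have hDdiag : ∀ v, s(v, v) ∉ D := fun v h => hE v (hDE h)
    have hDdeg : ∀ v, #{w | s(v, w) ∈ D} ≤ d := fun v =>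
      (card_le_card (monotone_filter_right _ fun w _ h => hDE h)).trans (hdeg v)
    set N : Finset V := {v ∈ Y | s(u, v) ∈ E} with hN
    have hXE : E ∩ X.sym2 = D ∪ starEdges u N := by
      rw [← inter_sym2_insert Y (hE u), hY, insert_erase hu]
    have hNd : #N ≤ d := (card_le_card (filter_subset_filter _ (subset_univ _))).trans (hdeg u)
    -- Starting at `m` is where the girth enters: by `hg` no shorter walk joins two distinct
    -- neighbours of `u`.
    let M : V → V → ℝ := fun v w =>
      b * ∑ k ∈ Ico m #Y, (c * b) ^ k * (edgeMatrix D ^ k) v w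
    have hM0 : ∀ v w, 0 ≤ M v w := fun v w => mul_nonneg hb (sum_nonneg fun k _ =>
      mul_nonneg (by positivity) (edgeMatrix_pow_nonneg D k v w))
    have hMs : ∀ v w, M v w = M w v := fun v w => by
      simp only [M, edgeMatrix_pow_symm D _ v w]
    have hM : ∀ v ∈ N, ∀ w ∈ N, v ≠ w → connWeight c D v w ≤ M v w := by
      intro v hv w hw hvw
      have h1 := connWeight_le_sum_walks hc0 hb hcb hDdiag hDdeg Y v (mem_filter.1 hv).1 w
      rw [hDD] at h1
      refine h1.trans (mul_le_mul_of_nonneg_left ?_ hb)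
      rw [← sum_filter_add_sum_filter_not (range #Y) (fun k => k < m), sum_eq_zero, zero_add]
      · refine le_of_eq (sum_congr ?_ fun _ _ => rfl)
        ext k
        simp only [mem_filter, mem_range, mem_Ico]
        omega
      · intro k hk
        rw [hg Y u huY v w (mem_filter.1 hv).2 (mem_filter.1 hw).2 hvw k (mem_filter.1 hk).2,
          mul_zero]
    have hself : ∀ v ∈ N, connWeight c D v v ≤ b := fun v hv => by
      have h1 := connWeight_self_le hc0 hb hcb hDdiag hDdeg Y v (mem_filter.1 hv).1
      rwa [hDD] at h1
    have hR : ∀ S : Finset V, u ∈ S →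
        ‖rankSum q (D ∩ Sᶜ.sym2)‖ ≤ ‖rankSum q D‖ * (1 - a)⁻¹ ^ (#S - 1) := by
      intro S huS
      have h1 := norm_rankSum_sdiff_le ha1 (q := q) (E := E) (Y := Y)
        (fun Z hZ => (ih Z (lt_of_le_of_lt hZ (erase_ssubset hu))).2) (Y ∩ S) inter_subset_left
      have h2 : E ∩ (Y \ (Y ∩ S)).sym2 = D ∩ Sᶜ.sym2 := by
        ext e
        induction e with
        | _ x y => simp only [hD, mem_inter, mk_mem_sym2_iff, mem_sdiff, mem_compl]; tauto
      rw [h2] at h1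
      refine h1.trans (mul_le_mul_of_nonneg_left (pow_le_pow_right₀ hinv ?_) (norm_nonneg _))
      -- Only `S` without `u` is removed from `Y`, hence the exponent `#S - 1`.
      rw [← card_erase_of_mem huS]
      refine card_le_card fun x hx => ?_
      rw [mem_inter] at hx
      exact mem_erase.2 ⟨fun h => huY (h ▸ hx.1), hx.2⟩
    have hstar := norm_rankSum_star_sub_le (r := (1 - a)⁻¹) (by positivity) hc hb hq
      (inter_subset_right (s₁ := E)) huY hR hM0 hMs N (by simp [hN, huY]) hself hM
    rw [← hXE, ← hD] at hstar
    have hMsum : ∑ v ∈ N, ∑ w ∈ N, M v w ≤ d * (b * (L ^ m / (1 - L))) := by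
      have h1 : ∀ v ∈ N, ∑ w ∈ N, M v w ≤ b * (L ^ m / (1 - L)) := by
        intro v _
        refine (sum_le_sum_of_subset_of_nonneg (subset_univ N) fun w _ _ => hM0 v w).trans ?_
        simp only [M]
        rw [← mul_sum, sum_comm]
        refine mul_le_mul_of_nonneg_left ?_ hb
        refine le_trans (sum_le_sum fun k _ => ?_) (geom_sum_Ico_le_of_lt_one (n := #Y) hL0 hL)
        rw [← mul_sum]
        calc _ ≤ (c * b) ^ k * (d : ℝ) ^ k := by
              gcongr
              exact sum_edgeMatrix_pow_le hDdeg k v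
          _ = (c * b * d) ^ k := (mul_pow _ _ _).symm
          _ ≤ L ^ k := by gcongr
      refine (sum_le_sum h1).trans ?_
      rw [sum_const, nsmul_eq_mul]
      have : 0 ≤ L ^ m / (1 - L) := div_nonneg (by positivity) (by linarith)
      gcongr
    have hL1 : 0 < 1 - L := by linarith
    have hmain : ‖rankSum q (E ∩ X.sym2) - (1 - q) ^ #N * rankSum q D‖ ≤
        ‖rankSum q D‖ * (b * L ^ (m + 1) / (2 * (1 - L))) := by
      refine hstar.trans (mul_le_mul_of_nonneg_left ?_ (norm_nonneg _))
      calc _ ≤ b * (c / 2 * (d * (b * (L ^ m / (1 - L))))) := by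
            have h0 : 0 ≤ ∑ v ∈ N, ∑ w ∈ N, M v w :=
              sum_nonneg fun v _ => sum_nonneg fun w _ => hM0 v w
            gcongr
            exact (pow_le_pow_right₀ (by linarith) hNd).trans hcb
        _ = b * (c * b * d * (L ^ m / (2 * (1 - L)))) := by
            field_simp
        -- The factor `c * b * d ≤ L` raises the exponent from `m` to `m + 1`.
        _ ≤ b * (L * (L ^ m / (2 * (1 - L)))) := by gcongr
        _ = _ := by rw [pow_succ]; ring
    have hpow : ‖(1 - q) ^ #N * rankSum q D - rankSum q D‖ ≤
        ‖rankSum q D‖ * ((1 + ‖q‖) ^ d - 1) := by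
      have h1 : (1 - q) ^ #N * rankSum q D - rankSum q D =
        rankSum q D * ((1 - q) ^ #N - 1) := by ring
      rw [h1, norm_mul]
      refine mul_le_mul_of_nonneg_left ?_ (norm_nonneg _)
      refine (norm_one_sub_pow_sub_one_le q _).trans (sub_le_sub_right ?_ 1)
      exact pow_le_pow_right₀ (by linarith [norm_nonneg q]) hNd
    have htri := norm_sub_le_norm_sub_add_norm_sub (rankSum q (E ∩ X.sym2))
      ((1 - q) ^ #N * rankSum q D) (rankSum q D)
    have h2 := norm_sub_norm_le (rankSum q D) (rankSum q (E ∩ X.sym2))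
    rw [norm_sub_rev] at h2
    have h3 := mul_le_mul_of_nonneg_left hab (norm_nonneg (rankSum q D))
    linarith
  refine ⟨?_, key⟩
  rcases X.eq_empty_or_nonempty with rfl | ⟨u, hu⟩
  · simp [rankSum_empty]
  · have h1 := key u hu
    have h2 := norm_pos_iff.2 (ih _ (erase_ssubset hu)).1
    exact norm_pos_iff.1 (lt_of_lt_of_le (by positivity) h1)

end Zeros

/-! ### Girth and the graph-theoretic conclusion -/

/-- Shorten the walk to a path and close it through `u` with the two given edges. -/
theorem egirth_le_of_walk {V : Type*} [DecidableEq V] {G : SimpleGraph V} {u v w : V}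
    (huv : G.Adj u v) (huw : G.Adj u w)
    (hvw : v ≠ w) (p : G.Walk v w) (hp : u ∉ p.support) : G.egirth ≤ (p.length + 2 : ℕ) := by
  have hb : u ∉ p.bypass.support := fun h => hp (p.support_bypass_subset_support h)
  have hpath : (p.bypass.concat huw.symm).IsPath := (p.bypass_isPath).concat hb huw.symm
  have hcyc : (SimpleGraph.Walk.cons huv (p.bypass.concat huw.symm)).IsCycle := by
    rw [SimpleGraph.Walk.cons_isCycle_iff]
    refine ⟨hpath, fun h => ?_⟩
    rw [SimpleGraph.Walk.edges_concat, List.concat_eq_append, List.mem_append] at h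
    rcases h with h | h
    · exact hb (p.bypass.fst_mem_support_of_mem_edges h)
    · rcases Sym2.eq_iff.1 (List.mem_singleton.1 h) with ⟨-, h⟩ | ⟨-, h⟩
      · exact huv.ne h.symm
      · exact hvw h
  refine hcyc.egirth_le_length.trans ?_
  rw [SimpleGraph.Walk.length_cons, SimpleGraph.Walk.length_concat]
  exact_mod_cast Nat.add_le_add_right p.length_bypass_le_length 2

section Graphs

open Finset

variable {V : Type*} [Fintype V] [DecidableEq V]

theorem aeval_chromaticPoly (G : SimpleGraph V) [DecidableRel G.Adj] {x : ℂ} (hx : x ≠ 0) :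
    Polynomial.aeval x (chromaticPoly G) =
      x ^ Fintype.card V * rankSum x⁻¹ G.edgeFinset := by
  simp only [chromaticPoly, natCard_connectedComponent, rankSum, map_sum, mul_sum]
  refine sum_congr rfl fun A _ => ?_
  have h : x ^ Fintype.card V = x ^ numClusters A * x ^ edgeRank A := by
    rw [← pow_add, edgeRank, Nat.add_sub_cancel' (numClusters_le A)]
  rw [h, inv_pow]
  simp only [map_mul, map_pow, map_neg, map_one, Polynomial.aeval_X]
  field_simp

theorem exists_walk_of_edgeMatrix_pow_ne_zero {G : SimpleGraph V} {D : Finset (Sym2 V)}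
    {X : Finset V} (hD : ∀ v w, s(v, w) ∈ D → G.Adj v w) (hDX : D ⊆ X.sym2) {u : V} (hu : u ∉ X)
    (k : ℕ) (v w : V) (hv : v ≠ u) (h : (edgeMatrix D ^ k) v w ≠ 0) :
    ∃ p : G.Walk v w, p.length = k ∧ u ∉ p.support := by
  induction k generalizing v with
  | zero =>
    rw [pow_zero, Matrix.one_apply] at h
    have hvw : v = w := by by_contra hne; simp [hne] at h
    subst hvw
    exact ⟨SimpleGraph.Walk.nil, rfl, by simpa using hv.symm⟩
  | succ k ih =>
    rw [pow_succ', Matrix.mul_apply] at h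
    obtain ⟨y, -, hy⟩ := exists_ne_zero_of_sum_ne_zero h
    have hvy : s(v, y) ∈ D := by
      by_contra hne
      simp [edgeMatrix, hne] at hy
    have hyu : y ≠ u := fun h => hu (h ▸ (mk_mem_sym2_iff.1 (hDX hvy)).2)
    obtain ⟨p, hp, hpu⟩ := ih y hyu (right_ne_zero_of_mul hy)
    exact ⟨SimpleGraph.Walk.cons (hD _ _ hvy) p, by simp [hp], by simp [hv.symm, hpu]⟩

theorem edgeMatrix_pow_eq_zero_of_lt_egirth {G : SimpleGraph V} [DecidableRel G.Adj] {g : ℕ}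
    (hG : (g : ℕ∞) ≤ G.egirth) (X : Finset V) (u : V) (hu : u ∉ X) (v w : V)
    (huv : s(u, v) ∈ G.edgeFinset) (huw : s(u, w) ∈ G.edgeFinset) (hvw : v ≠ w) (k : ℕ)
    (hk : k < g - 2) : (edgeMatrix (G.edgeFinset ∩ X.sym2) ^ k) v w = 0 := by
  by_contra h
  rw [SimpleGraph.mem_edgeFinset, SimpleGraph.mem_edgeSet] at huv huw
  obtain ⟨p, hp, hpu⟩ := exists_walk_of_edgeMatrix_pow_ne_zero (G := G)
    (fun v w hvw => by simpa using (mem_inter.1 hvw).1) inter_subset_right hu k v w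
    huv.ne' h
  have h1 := hG.trans (egirth_le_of_walk huv huw hvw p hpu)
  rw [hp, Nat.cast_le] at h1
  omega

/-- Take `L = ln b`, `d` the maximum degree and `m = g - 2`. Since `(1 + t) ^ d ≤ exp (t * d)`, the
lower bound on `‖x‖` yields all hypotheses of the induction. -/
theorem chromaticPoly_ne_zero_of_feasible {g : ℕ} (hg : 3 ≤ g) {p : ℝ × ℝ}
    (hp : p ∈ girthFeasible g) (G : SimpleGraph V) [DecidableRel G.Adj]
    (hG : (g : ℕ∞) ≤ G.egirth) {x : ℂ} (hx0 : G = ⊥ → x ≠ 0)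
    (hx : girthObjective p * G.maxDegree ≤ ‖x‖) :
    Polynomial.aeval x (chromaticPoly G) ≠ 0 := by
  obtain ⟨a, b⟩ := p
  obtain ⟨hf, ⟨ha0, ha9⟩, hb1, hbe⟩ := hp
  simp only [girthConstraint, girthObjective] at hf ha0 ha9 hb1 hbe hx
  have hb0 : 0 < b := by linarith
  have ha : 0 < 1 - a := by linarith
  have hL0 : 0 < Real.log b := Real.log_pos (by linarith)
  have hL1 : Real.log b < 1 := (Real.log_lt_iff_lt_exp hb0).2 hbe
  have hxne : x ≠ 0 := by
    by_cases hbot : G = ⊥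
    · exact hx0 hbot
    · obtain ⟨v, w, hvw⟩ := SimpleGraph.ne_bot_iff_exists_adj.1 hbot
      have h1 : 0 < G.maxDegree := lt_of_lt_of_le
        ((G.degree_pos_iff_exists_adj v).2 ⟨w, hvw⟩) (G.degree_le_maxDegree v)
      have h2 : (0 : ℝ) < G.maxDegree := by exact_mod_cast h1
      have h3 : 0 < b / ((1 - a) * Real.log b) * G.maxDegree := by positivity
      exact norm_pos_iff.1 (h3.trans_le hx)
  have hxpos : 0 < ‖x‖ := norm_pos_iff.2 hxne
  have hq : ‖x⁻¹‖ * G.maxDegree ≤ (1 - a) * Real.log b / b := by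
    rw [norm_inv, inv_mul_le_iff₀ hxpos]
    have h1 := mul_le_mul_of_nonneg_right hx
      (show 0 ≤ (1 - a) * Real.log b / b by positivity)
    refine le_trans (le_of_eq ?_) h1
    field_simp
  have hcd : ‖x⁻¹‖ * (1 - a)⁻¹ * b * G.maxDegree ≤ Real.log b := by
    have h1 := mul_le_mul_of_nonneg_right hq (show 0 ≤ (1 - a)⁻¹ * b by positivity)
    refine le_trans (le_of_eq (by ring)) (h1.trans (le_of_eq ?_))
    field_simp
  have hpow : ∀ t : ℝ, 0 ≤ t → (1 + t) ^ G.maxDegree ≤ Real.exp (t * G.maxDegree) := by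
    intro t ht
    rw [mul_comm, Real.exp_nat_mul]
    exact pow_le_pow_left₀ (by linarith) (by linarith [Real.add_one_le_exp t]) _
  have hcb : (1 + ‖x⁻¹‖ * (1 - a)⁻¹ * b) ^ G.maxDegree ≤ b := by
    refine (hpow _ (by positivity)).trans ?_
    calc _ ≤ Real.exp (Real.log b) := Real.exp_le_exp.2 hcd
      _ = b := Real.exp_log hb0
  have hdeg : ∀ v, #{w | s(v, w) ∈ G.edgeFinset} ≤ G.maxDegree := by
    intro v
    refine le_trans (le_of_eq ?_) (G.degree_le_maxDegree v)
    rw [← SimpleGraph.card_neighborFinset_eq_degree]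
    congr 1
    ext w
    simp
  have hab : (1 + ‖x⁻¹‖) ^ G.maxDegree - 1 +
      b * Real.log b ^ (g - 2 + 1) / (2 * (1 - Real.log b)) ≤ a := by
    have h1 := (hpow ‖x⁻¹‖ (norm_nonneg _)).trans (Real.exp_le_exp.2 hq)
    rw [show g - 2 + 1 = g - 1 by omega]
    linarith
  have hmain := (rankSum_ne_zero_and_le ha0 (by linarith) hL1 hcb hcd hb0.le hab
    (fun v => by simp) hdeg (edgeMatrix_pow_eq_zero_of_lt_egirth hG) univ).1
  rw [sym2_univ, inter_univ] at hmain
  rw [aeval_chromaticPoly G hxne]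
  exact mul_ne_zero (pow_ne_zero _ hxne) hmain

end Graphs

/-! ### The feasible set and attainment of the minimum -/

section Optimisation

theorem log_mem_of_feasible {g : ℕ} {p : ℝ × ℝ} (hp : p ∈ girthFeasible g) :
    0 < p.2 ∧ 0 < 1 - p.1 ∧ 0 < Real.log p.2 ∧ Real.log p.2 < 1 := by
  obtain ⟨-, ⟨-, h9⟩, hb1, hbe⟩ := hp
  have hb : 0 < p.2 := by linarith
  exact ⟨hb, by linarith, Real.log_pos (by linarith), (Real.log_lt_iff_lt_exp hb).2 hbe⟩

/-- Used for compactness: after clearing the denominator the constraint is continuous up to `b = e`,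
and there it would read `e ≤ 0`, so closing the interval adds no points. -/
theorem girthFeasible_eq (g : ℕ) : girthFeasible g =
    (Set.Icc (0 : ℝ) 0.9 ×ˢ Set.Icc (1.1 : ℝ) (Real.exp 1)) ∩
      (fun p : ℝ × ℝ => (Real.exp ((1 - p.1) * Real.log p.2 / p.2) - 1 - p.1) *
        (2 * (1 - Real.log p.2)) + p.2 * Real.log p.2 ^ (g - 1)) ⁻¹' Set.Iic 0 := by
  have key : ∀ p : ℝ × ℝ, Real.log p.2 < 1 → (girthConstraint g p.1 p.2 ≤ p.1 ↔
      (Real.exp ((1 - p.1) * Real.log p.2 / p.2) - 1 - p.1) *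
        (2 * (1 - Real.log p.2)) + p.2 * Real.log p.2 ^ (g - 1) ≤ 0) := by
    intro p hp
    have h1 : 0 < 2 * (1 - Real.log p.2) := by linarith
    rw [girthConstraint, ← le_sub_iff_add_le', div_le_iff₀ h1]
    constructor <;> intro h <;> linarith
  ext p
  simp only [girthFeasible, Set.mem_inter_iff, Set.mem_prod, Set.mem_preimage, Set.mem_Iic,
    Set.mem_ofPred_eq]
  constructor
  · rintro ⟨h, ha, hb⟩
    refine ⟨⟨ha, hb.1, hb.2.le⟩, (key p ?_).1 h⟩
    exact (Real.log_lt_iff_lt_exp (by linarith [hb.1])).2 hb.2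
  · rintro ⟨⟨ha, hb1, hb2⟩, h⟩
    have hlt : p.2 < Real.exp 1 := by
      refine lt_of_le_of_ne hb2 fun hbe => ?_
      rw [hbe, Real.log_exp, one_pow, sub_self, mul_zero, mul_zero, zero_add, mul_one] at h
      exact absurd (Real.exp_pos 1) (not_lt.2 h)
    refine ⟨(key p ?_).2 h, ha, hb1, hlt⟩
    exact (Real.log_lt_iff_lt_exp (by linarith)).2 hlt

theorem isCompact_girthFeasible (g : ℕ) : IsCompact (girthFeasible g) := by
  rw [girthFeasible_eq]
  have hne : ∀ p ∈ Set.Icc (0 : ℝ) 0.9 ×ˢ Set.Icc (1.1 : ℝ) (Real.exp 1), p.2 ≠ 0 :=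
    fun p hp => by linarith [hp.2.1]
  have hK : IsCompact (Set.Icc (0 : ℝ) 0.9 ×ˢ Set.Icc (1.1 : ℝ) (Real.exp 1)) :=
    isCompact_Icc.prod isCompact_Icc
  have hlog : ContinuousOn (fun p : ℝ × ℝ => Real.log p.2)
      (Set.Icc (0 : ℝ) 0.9 ×ˢ Set.Icc (1.1 : ℝ) (Real.exp 1)) := continuousOn_snd.log hne
  refine hK.of_isClosed_subset (ContinuousOn.preimage_isClosed_of_isClosed ?_ hK.isClosed
    isClosed_Iic) Set.inter_subset_left
  have hexp := ((((continuousOn_const (c := (1 : ℝ))).sub continuousOn_fst).mul hlog).div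
    continuousOn_snd hne).rexp
  fun_prop

theorem girthFeasible_subset {g : ℕ} (hg : 3 ≤ g) : girthFeasible 3 ⊆ girthFeasible g := by
  intro p hp
  obtain ⟨hb, ha, hL0, hL1⟩ := log_mem_of_feasible hp
  refine ⟨le_trans ?_ hp.1, hp.2⟩
  have h1 : 0 < 1 - Real.log p.2 := by linarith
  have h2 : Real.log p.2 ^ (g - 1) ≤ Real.log p.2 ^ (3 - 1) :=
    pow_le_pow_of_le_one hL0.le hL1.le (by omega)
  unfold girthConstraint
  gcongr

theorem girthFeasible_nonempty {g : ℕ} (hg : 3 ≤ g) : (girthFeasible g).Nonempty := by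
  -- An explicit point for `g = 3` suffices, as the tail term decreases in `g`.
  refine ⟨(1 / 2, Real.exp (1 / 4)), girthFeasible_subset hg ⟨?_, ?_, ?_, ?_⟩⟩
  · have h1 : Real.exp (1 / 4) ≤ 1.3 := by
      refine le_of_pow_le_pow_left₀ (n := 4) (by norm_num) (by norm_num) ?_
      rw [← Real.exp_nat_mul]
      norm_num
      linarith [Real.exp_one_lt_d9]
    have h2 : Real.exp ((1 - 1 / 2) * Real.log (Real.exp (1 / 4)) / Real.exp (1 / 4)) ≤
        Real.exp (1 / 4) := by
      rw [Real.log_exp, Real.exp_le_exp, div_le_iff₀ (Real.exp_pos _)]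
      linarith [Real.one_le_exp (show (0 : ℝ) ≤ 1 / 4 by norm_num)]
    simp only [girthConstraint]
    rw [Real.log_exp] at h2 ⊢
    have h3 := h2.trans h1
    norm_num at h1 h3 ⊢
    linarith
  · norm_num
  · have := Real.add_one_le_exp (1 / 4)
    norm_num at this ⊢
    linarith
  · exact Real.exp_lt_exp.2 (by norm_num)

theorem isLeast_girthK {g : ℕ} (hg : 3 ≤ g) :
    IsLeast (girthObjective '' girthFeasible g) (girthK g) := by
  refine IsCompact.isLeast_sInf ((isCompact_girthFeasible g).image_of_continuousOn ?_)
    ((girthFeasible_nonempty hg).image _)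
  have hlog : ContinuousOn (fun p : ℝ × ℝ => Real.log p.2) (girthFeasible g) :=
    continuousOn_snd.log fun p hp => (log_mem_of_feasible hp).1.ne'
  refine continuousOn_snd.div ((continuousOn_const.sub continuousOn_fst).mul hlog) fun p hp => ?_
  obtain ⟨-, h1, h2, -⟩ := log_mem_of_feasible hp
  exact (mul_pos h1 h2).ne'

/-! ### The limiting constant -/

/-- The reciprocal of the limit of `girthK`. -/
noncomputable def limitRate : ℝ := 1 + Real.log (lambertW (Real.exp (2 / Real.exp 1 - 1)))

theorem strictMono_exp_add_mul : StrictMono fun h : ℝ => Real.exp h + Real.exp 1 * h :=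
  Real.exp_strictMono.add (strictMono_mul_left_of_pos (Real.exp_pos 1))

/-- With `w = exp (h - 1)` the equation `exp h + e h = 2` becomes `w + ln w = 2/e - 1`, the
logarithm of the equation defining `W`. -/
theorem exp_limitRate_add : Real.exp limitRate + Real.exp 1 * limitRate = 2 := by
  unfold limitRate
  set w := lambertW (Real.exp (2 / Real.exp 1 - 1)) with hw
  have h1 : w * Real.exp w = Real.exp (2 / Real.exp 1 - 1) :=
    (lambertW_unique (Real.exp_pos _) w).2 hw
  have hpos : 0 < w := pos_of_mul_pos_left (h1 ▸ Real.exp_pos _) (Real.exp_pos w).le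
  have h2 : Real.log w + w = 2 / Real.exp 1 - 1 := by
    rw [← Real.log_exp (2 / Real.exp 1 - 1), ← h1, Real.log_mul hpos.ne' (Real.exp_pos w).ne',
      Real.log_exp]
  have h3 : Real.log w = 2 / Real.exp 1 - 1 - w := by linarith
  have he : Real.exp 1 ≠ 0 := (Real.exp_pos 1).ne'
  rw [Real.exp_add, Real.exp_log hpos, h3]
  field_simp
  ring

/-- Monotonicity of `exp h + e h` reduces both bounds to comparing its value with 2, done with eight
Taylor terms. -/
theorem limitRate_bounds : 1 / 3.859775 ≤ limitRate ∧ limitRate ≤ 1 / 3.859765 := by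
  have he1 := Real.exp_one_gt_d9
  have he2 := Real.exp_one_lt_d9
  constructor
  · rw [← strictMono_exp_add_mul.le_iff_le]
    simp only [exp_limitRate_add]
    have h := Real.exp_bound' (x := 1 / 3.859775) (by norm_num) (by norm_num)
      (show 0 < 8 by norm_num)
    simp only [Finset.sum_range_succ, Finset.sum_range_zero, Nat.factorial] at h
    norm_num at h ⊢
    linarith
  · rw [← strictMono_exp_add_mul.le_iff_le]
    simp only [exp_limitRate_add]
    have h := Real.sum_le_exp_of_nonneg (x := 1 / 3.859765) (by norm_num) 8
    simp only [Finset.sum_range_succ, Finset.sum_range_zero, Nat.factorial] at h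
    norm_num at h ⊢
    linarith

theorem log_div_le (b : ℝ) (hb : 0 < b) : Real.log b / b ≤ 1 / Real.exp 1 := by
  have h1 := Real.log_le_sub_one_of_pos (show 0 < b / Real.exp 1 by positivity)
  rw [Real.log_div hb.ne' (Real.exp_pos 1).ne', Real.log_exp] at h1
  rw [div_le_div_iff₀ hb (Real.exp_pos 1), one_mul, ← le_div_iff₀ (Real.exp_pos 1)]
  linarith

theorem one_div_limitRate_le {g : ℕ} {p : ℝ × ℝ} (hp : p ∈ girthFeasible g) :
    1 / limitRate ≤ girthObjective p := by
  obtain ⟨hb, ha, hL0, hL1⟩ := log_mem_of_feasible hp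
  have hf := hp.1
  rw [girthConstraint] at hf
  have hL1' : 0 < 1 - Real.log p.2 := by linarith
  have hpos : 0 ≤ p.2 * Real.log p.2 ^ (g - 1) / (2 * (1 - Real.log p.2)) := by positivity
  set h := (1 - p.1) * Real.log p.2 / p.2 with hh
  have hh0 : 0 < h := by positivity
  have hle : Real.exp 1 * h ≤ 1 - p.1 := by
    have h1 := mul_le_mul_of_nonneg_left (log_div_le p.2 hb) ha.le
    rw [← mul_div_assoc, ← mul_div_assoc, mul_one, le_div_iff₀ (Real.exp_pos 1)] at h1
    linarith
  have hlim : h ≤ limitRate := by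
    rw [← strictMono_exp_add_mul.le_iff_le]
    simp only [exp_limitRate_add]
    linarith
  have hobj : girthObjective p = 1 / h := by
    rw [girthObjective, hh, one_div_div]
  rw [hobj]
  exact one_div_le_one_div_of_le hh0 hlim

/-- The limiting optimum has `b = e`, which is excluded, and no slack. Moving to `(a + t, e - t)`
with small `t > 0` repairs both, and the objective is continuous there. -/
theorem exists_girthObjective_lt {K : ℝ} (hK : 1 / limitRate < K) : ∃ p : ℝ × ℝ,
    girthObjective p < K ∧ Real.exp ((1 - p.1) * Real.log p.2 / p.2) - 1 < p.1 ∧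
      p.1 ∈ Set.Icc (0 : ℝ) 0.9 ∧ p.2 ∈ Set.Ico (1.1 : ℝ) (Real.exp 1) := by
  have he1 := Real.exp_one_gt_d9
  have he2 := Real.exp_one_lt_d9
  have hr := exp_limitRate_add
  have hr1 := limitRate_bounds.1
  have hr0 : 0 < limitRate := lt_of_lt_of_le (by norm_num) hr1
  set a := 1 - Real.exp 1 * limitRate with ha
  have ha0 : 0 < a := by
    have := Real.add_one_lt_exp hr0.ne'
    linarith
  have ha1 : a ≤ 0.5 := by
    have : (2 : ℝ) * (1 / 3.859775) ≤ Real.exp 1 * limitRate := by gcongr; linarith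
    norm_num at this ⊢
    linarith
  have hcont : Filter.Tendsto (fun t : ℝ => girthObjective (a + t, Real.exp 1 - t)) (𝓝 0)
      (𝓝 (1 / limitRate)) := by
    have h0 : girthObjective (a + 0, Real.exp 1 - 0) = 1 / limitRate := by
      simp only [girthObjective, add_zero, sub_zero, Real.log_exp, ha]
      field_simp
      ring
    rw [← h0]
    refine ContinuousAt.tendsto (f := fun t : ℝ => girthObjective (a + t, Real.exp 1 - t)) ?_
    unfold girthObjective
    refine ContinuousAt.div (by fun_prop) (ContinuousAt.mul (by fun_prop)
      (ContinuousAt.log (by fun_prop) (by simp))) ?_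
    simp only [add_zero, sub_zero, Real.log_exp, mul_one]
    linarith
  have hev : ∀ᶠ t in 𝓝[>] (0 : ℝ),
      girthObjective (a + t, Real.exp 1 - t) < K ∧ t ∈ Set.Ioo (0 : ℝ) 0.1 :=
    ((hcont.mono_left nhdsWithin_le_nhds).eventually_lt_const hK).and
      (Ioo_mem_nhdsGT (by norm_num))
  obtain ⟨t, ht, ht0, ht1⟩ := hev.exists
  norm_num at ht1 ha1
  refine ⟨(a + t, Real.exp 1 - t), ht, ?_, ⟨by simp only; linarith, ?_⟩, ?_, ?_⟩
  · simp only
    have hb : 0 < Real.exp 1 - t := by linarith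
    have h1 := mul_le_mul_of_nonneg_left (log_div_le _ hb) (show 0 ≤ 1 - (a + t) by linarith)
    have h2 : (1 - (a + t)) * (1 / Real.exp 1) ≤ limitRate := by
      rw [mul_one_div, div_le_iff₀ (Real.exp_pos 1)]
      linarith
    rw [← mul_div_assoc] at h1
    have h3 := Real.exp_le_exp.2 (h1.trans h2)
    linarith
  · norm_num
    linarith
  · norm_num
    linarith
  · simp only
    linarith

/-- The lower bound is uniform in `g`. For the upper bound a fixed near-optimal point has strict
slack, so it becomes feasible once the tail term is small. -/
theorem tendsto_girthK : Filter.Tendsto girthK Filter.atTop (𝓝 (1 / limitRate)) := by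
  rw [tendsto_order]
  constructor
  · intro l hl
    filter_upwards [Filter.eventually_ge_atTop 3] with g hg
    obtain ⟨p, hp, hpK⟩ := (isLeast_girthK hg).1
    rw [← hpK]
    exact hl.trans_le (one_div_limitRate_le hp)
  · intro K hK
    obtain ⟨p, hobj, hlt, ha, hb⟩ := exists_girthObjective_lt hK
    have hb0 : 0 < p.2 := by linarith [hb.1]
    have hL0 : 0 ≤ Real.log p.2 := Real.log_nonneg (by linarith [hb.1])
    have hL1 : Real.log p.2 < 1 := (Real.log_lt_iff_lt_exp hb0).2 hb.2
    have hpow := (tendsto_pow_atTop_nhds_zero_of_lt_one hL0 hL1).comp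
      (Filter.tendsto_sub_atTop_nat 1)
    have hlim : Filter.Tendsto (fun g => girthConstraint g p.1 p.2) Filter.atTop
        (𝓝 (Real.exp ((1 - p.1) * Real.log p.2 / p.2) - 1)) := by
      have h1 := ((hpow.const_mul p.2).div_const (2 * (1 - Real.log p.2))).const_add
        (Real.exp ((1 - p.1) * Real.log p.2 / p.2) - 1)
      rw [mul_zero, zero_div, add_zero] at h1
      exact h1
    filter_upwards [Filter.eventually_ge_atTop 3, hlim.eventually_le_const hlt] with g hg hle
    exact ((isLeast_girthK hg).2 ⟨p, ⟨hle, ha, hb⟩, rfl⟩).trans_lt hobj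

theorem abs_one_div_limitRate_sub_le : |1 / limitRate - 3.85977| ≤ 0.000005 := by
  obtain ⟨h1, h2⟩ := limitRate_bounds
  have h0 : 0 < limitRate := lt_of_lt_of_le (by norm_num) h1
  have h3 := one_div_le_one_div_of_le (by norm_num) h1
  have h4 := one_div_le_one_div_of_le h0 h2
  rw [one_div_one_div] at h3 h4
  rw [abs_le]
  constructor <;> norm_num at h3 h4 ⊢ <;> linarith

end Optimisation

theorem theorem1p2 :
    (∀ g : ℕ, 3 ≤ g →
      IsLeast (girthObjective '' girthFeasible g) (girthK g) ∧
      ∀ (V : Type*) [Fintype V] [DecidableEq V] (G : SimpleGraph V) [DecidableRel G.Adj],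
        (g : ℕ∞) ≤ G.egirth →
        ∀ x : ℂ, (G = ⊥ → x ≠ 0) → girthK g * (G.maxDegree : ℝ) ≤ ‖x‖ →
          Polynomial.aeval x (chromaticPoly G) ≠ 0) ∧
    Filter.Tendsto girthK Filter.atTop
      (𝓝 (1 / (1 + Real.log (lambertW (Real.exp (2 / Real.exp 1 - 1)))))) ∧
    1 / (1 + Real.log (lambertW (Real.exp (2 / Real.exp 1 - 1)))) ≤ (3.86 : ℝ) ∧
    |1 / (1 + Real.log (lambertW (Real.exp (2 / Real.exp 1 - 1)))) - (3.85977 : ℝ)|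
      ≤ 0.000005 := by
  refine ⟨fun g hg => ⟨isLeast_girthK hg, ?_⟩, tendsto_girthK, ?_, abs_one_div_limitRate_sub_le⟩
  · intro V _ _ G _ hG x hx0 hx
    obtain ⟨p, hp, hpK⟩ := (isLeast_girthK hg).1
    exact chromaticPoly_ne_zero_of_feasible hg hp G hG hx0 (hpK ▸ hx)
  · have h := (abs_le.1 abs_one_div_limitRate_sub_le).2
    rw [limitRate] at h
    norm_num at h ⊢
    linarith
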